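/- Let $n\ge 2$. For a convex body $K\subset\mathbb{R}^n$ (compact convex set) with the origin in its interior, let $h_K(u)=\max_{x\in K}\langle x,u\rangle$ be its support function, $F(K,u)=\{x\in K:\langle x,u\rangle=h_K(u)\}$ its face with exterior normal $u\in S^{n-1}$, $\partial_*K$ the set of boundary points of $K$ that have a unique exterior unit normal, and $\nu_K(x)$ this normal for $x\in\partial_*K$. The cone volume measure of $K$ is the Borel measure on $S^{n-1}$ given by $$V_K(\omega)=\int_{\nu_K^{-1}(\omega)}\frac{\langle x,\nu_K(x)\rangle}{n}\,d\mathcal{H}^{n-1}(x),$$ where $\mathcal{H}^{n-1}$ is the $(n-1)$-dimensional Hausdorff measure, normalized to agree with Lebesgue measure on hyperplanes. For $\alpha,\beta>0$ let $$\varphi(\alpha,\beta,n)=\min_{\varrho>0}\left(\frac{\alpha}{\varrho^{n-1}}+\beta\varrho^{n-1}\right)\sum_{i=0}^{n-1}\varrho^{n-1-2i};$$ the minimum is attained at a unique point $\varrho>0$, which depends only on $\alpha/\beta$ and $n$ and is denoted by $\varrho_0(\alpha/\beta,n)$. **Theorem.** Let $K\subset\mathbb{R}^n$ be a convex body with the origin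 in its interior and with volume $V(K)=1$, and let $u\in S^{n-1}$ be such that $V_K(\{u\})=\alpha>0$ and $V_K(\{-u\})=\beta>0$. Then $\varphi(\alpha,\beta,n)\le 1$. Equality holds if and only if all three of the following conditions hold: $F(K,u)$ and $F(K,-u)$ are (positively) homothetic, that is, $F(K,u)=t+c\,F(K,-u)$ for some $t\in\mathbb{R}^n$ and $c>0$; $K$ is the convex hull of $F(K,u)\cup F(K,-u)$; and $$\frac{h_K(u)}{h_K(-u)}=\frac{\alpha}{\beta}\cdot\varrho_0\!\left(\frac{\alpha}{\beta},n\right)^{-2(n-1)}.$$ -/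

import Mathlib

open MeasureTheory Set
open scoped InnerProductSpace

namespace ConvexBody

variable {n : ℕ}

/-- The support function `h_K(u) = max {⟪x, u⟫ : x ∈ K}`. -/
noncomputable def supportFunction (K : ConvexBody (EuclideanSpace ℝ (Fin n)))
    (u : EuclideanSpace ℝ (Fin n)) : ℝ :=
  sSup ((fun x => ⟪x, u⟫_ℝ) '' (K : Set (EuclideanSpace ℝ (Fin n))))

/-- The face `F(K, u) = {x ∈ K : ⟪x, u⟫ = h_K(u)}` of `K` with exterior normal `u`. -/
def face (K : ConvexBody (EuclideanSpace ℝ (Fin n))) (u : EuclideanSpace ℝ (Fin n)) :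
    Set (EuclideanSpace ℝ (Fin n)) :=
  {x | x ∈ K ∧ ⟪x, u⟫_ℝ = K.supportFunction u}

/-- `u` is an exterior normal vector of `K` at `x`. -/
def IsOuterNormal (K : ConvexBody (EuclideanSpace ℝ (Fin n)))
    (x u : EuclideanSpace ℝ (Fin n)) : Prop :=
  ∀ y ∈ K, ⟪y, u⟫_ℝ ≤ ⟪x, u⟫_ℝ

/-- The set `∂_* K` of all boundary points of `K` having a unique exterior unit normal. -/
def regularBoundary (K : ConvexBody (EuclideanSpace ℝ (Fin n))) :
    Set (EuclideanSpace ℝ (Fin n)) :=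
  {x | x ∈ frontier (K : Set (EuclideanSpace ℝ (Fin n))) ∧
    ∃! u : Metric.sphere (0 : EuclideanSpace ℝ (Fin n)) 1, K.IsOuterNormal x u}

/-- The Gauss map `ν_K`, assigning to `x ∈ ∂_* K` its unique exterior unit normal. -/
noncomputable def gaussMap (K : ConvexBody (EuclideanSpace ℝ (Fin n)))
    (x : K.regularBoundary) : Metric.sphere (0 : EuclideanSpace ℝ (Fin n)) 1 :=
  x.2.2.choose

/-- The cone volume measure of `K`, a Borel measure on the unit sphere:
`V_K(ω) = ∫_{ν_K⁻¹(ω)} ⟪x, ν_K(x)⟫ / n dℋ^{n-1}(x)`, where `ℋ^{n-1}` is the Hausdorff measure,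
normalized to agree with `(n-1)`-dimensional Lebesgue measure on hyperplanes.
See `coneVolumeMeasure_apply`. -/
noncomputable def coneVolumeMeasure (K : ConvexBody (EuclideanSpace ℝ (Fin n))) :
    Measure (Metric.sphere (0 : EuclideanSpace ℝ (Fin n)) 1) :=
  (((μHE[n - 1] : Measure (EuclideanSpace ℝ (Fin n))).comap
      (Subtype.val : K.regularBoundary → EuclideanSpace ℝ (Fin n))).withDensity
    (fun x => ENNReal.ofReal
      (⟪(x : EuclideanSpace ℝ (Fin n)), (K.gaussMap x : EuclideanSpace ℝ (Fin n))⟫_ℝ / n))).map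
    K.gaussMap

theorem gaussMap_spec (K : ConvexBody (EuclideanSpace ℝ (Fin n))) (x : K.regularBoundary) :
    K.IsOuterNormal x (K.gaussMap x) :=
  x.2.2.choose_spec.1

theorem gaussMap_unique (K : ConvexBody (EuclideanSpace ℝ (Fin n))) (x : K.regularBoundary)
    (u : Metric.sphere (0 : EuclideanSpace ℝ (Fin n)) 1) (hu : K.IsOuterNormal x u) :
    u = K.gaussMap x :=
  x.2.2.choose_spec.2 u hu

theorem isClosed_setOf_isOuterNormal (K : ConvexBody (EuclideanSpace ℝ (Fin n))) :
    IsClosed {p : EuclideanSpace ℝ (Fin n) × Metric.sphere (0 : EuclideanSpace ℝ (Fin n)) 1 |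
      K.IsOuterNormal p.1 p.2} := by
  have : {p : EuclideanSpace ℝ (Fin n) × Metric.sphere (0 : EuclideanSpace ℝ (Fin n)) 1 |
      K.IsOuterNormal p.1 p.2} = ⋂ y ∈ K, {p | ⟪y, (p.2 : EuclideanSpace ℝ (Fin n))⟫_ℝ ≤
        ⟪p.1, (p.2 : EuclideanSpace ℝ (Fin n))⟫_ℝ} := by
    ext p
    simp [IsOuterNormal]
  rw [this]
  refine isClosed_biInter fun y _ => isClosed_le ?_ ?_ <;> fun_prop

theorem continuous_gaussMap (K : ConvexBody (EuclideanSpace ℝ (Fin n))) :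
    Continuous K.gaussMap := by
  rw [continuous_iff_isClosed]
  intro C hC
  have h1 : IsClosed (Prod.fst '' ({p : EuclideanSpace ℝ (Fin n) ×
      Metric.sphere (0 : EuclideanSpace ℝ (Fin n)) 1 | K.IsOuterNormal p.1 p.2} ∩
      {p | p.2 ∈ C})) :=
    isClosedMap_fst_of_compactSpace _
      (K.isClosed_setOf_isOuterNormal.inter (hC.preimage continuous_snd))
  convert h1.preimage (continuous_subtype_val (p := fun x => x ∈ K.regularBoundary)) using 1
  ext x
  simp only [mem_preimage, mem_image, mem_inter_iff, mem_ofPred_eq, Prod.exists,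
    exists_and_right, exists_eq_right]
  constructor
  · intro h
    exact ⟨_, K.gaussMap_spec x, h⟩
  · rintro ⟨v, hv, hvC⟩
    rwa [← K.gaussMap_unique x v hv]

theorem measurableSet_regularBoundary (K : ConvexBody (EuclideanSpace ℝ (Fin n))) :
    MeasurableSet K.regularBoundary := by
  let S := Metric.sphere (0 : EuclideanSpace ℝ (Fin n)) 1
  have hA : IsClosed (Prod.fst '' {p : EuclideanSpace ℝ (Fin n) × S |
      K.IsOuterNormal p.1 p.2}) :=
    isClosedMap_fst_of_compactSpace _ K.isClosed_setOf_isOuterNormal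
  have hB : ∀ k : ℕ, IsClosed (Prod.fst '' {p : EuclideanSpace ℝ (Fin n) × (S × S) |
      K.IsOuterNormal p.1 p.2.1 ∧ K.IsOuterNormal p.1 p.2.2 ∧
        1 / ((k : ℝ) + 1) ≤ dist p.2.1 p.2.2}) := by
    intro k
    refine isClosedMap_fst_of_compactSpace _ ?_
    have e1 := K.isClosed_setOf_isOuterNormal.preimage
      (f := fun p : EuclideanSpace ℝ (Fin n) × (S × S) => (p.1, p.2.1)) (by fun_prop)
    have e2 := K.isClosed_setOf_isOuterNormal.preimage
      (f := fun p : EuclideanSpace ℝ (Fin n) × (S × S) => (p.1, p.2.2)) (by fun_prop)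
    have e3 : IsClosed {p : EuclideanSpace ℝ (Fin n) × (S × S) |
        1 / ((k : ℝ) + 1) ≤ dist p.2.1 p.2.2} :=
      isClosed_le continuous_const (by fun_prop)
    exact e1.inter (e2.inter e3)
  have key : K.regularBoundary = (frontier (K : Set (EuclideanSpace ℝ (Fin n))) ∩
      Prod.fst '' {p : EuclideanSpace ℝ (Fin n) × S | K.IsOuterNormal p.1 p.2}) \
      ⋃ k : ℕ, Prod.fst '' {p : EuclideanSpace ℝ (Fin n) × (S × S) |
      K.IsOuterNormal p.1 p.2.1 ∧ K.IsOuterNormal p.1 p.2.2 ∧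
        1 / ((k : ℝ) + 1) ≤ dist p.2.1 p.2.2} := by
    ext x
    constructor
    · rintro ⟨hx, u, hu, huniq⟩
      refine ⟨⟨hx, (x, u), hu, rfl⟩, ?_⟩
      rw [mem_iUnion]
      rintro ⟨k, ⟨y, v, w⟩, ⟨hv, hw, hd⟩, rfl⟩
      have hvu : v = u := huniq v hv
      have hwu : w = u := huniq w hw
      subst hvu
      subst hwu
      simp only [dist_self] at hd
      have : (0 : ℝ) < 1 / ((k : ℝ) + 1) := by positivity
      linarith
    · rintro ⟨⟨hx, ⟨y, u⟩, hu, rfl⟩, hno⟩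
      refine ⟨hx, u, hu, ?_⟩
      intro v hv
      by_contra hne
      apply hno
      obtain ⟨k, hk⟩ := exists_nat_one_div_lt (dist_pos.2 hne)
      exact mem_iUnion.2 ⟨k, (y, v, u), ⟨hv, hu, hk.le⟩, rfl⟩
  rw [key]
  exact (isClosed_frontier.measurableSet.inter hA.measurableSet).diff
    (MeasurableSet.iUnion fun k => (hB k).measurableSet)

/-- The defining formula of the cone volume measure, for every Borel set `ω`. -/
theorem coneVolumeMeasure_apply (K : ConvexBody (EuclideanSpace ℝ (Fin n)))
    {ω : Set (Metric.sphere (0 : EuclideanSpace ℝ (Fin n)) 1)} (hω : MeasurableSet ω) :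
    K.coneVolumeMeasure ω = ∫⁻ x in K.gaussMap ⁻¹' ω, ENNReal.ofReal
      (⟪(x : EuclideanSpace ℝ (Fin n)), (K.gaussMap x : EuclideanSpace ℝ (Fin n))⟫_ℝ / n)
      ∂((μHE[n - 1] : Measure (EuclideanSpace ℝ (Fin n))).comap
        (Subtype.val : K.regularBoundary → EuclideanSpace ℝ (Fin n))) := by
  have hm := K.continuous_gaussMap.measurable
  rw [coneVolumeMeasure, Measure.map_apply hm hω, withDensity_apply _ (hm hω)]

end ConvexBody

/-- `A` and `B` are (positively) homothetic: `A = t + c B` for a vector `t` and some `c > 0`. -/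
def AreHomothetic {n : ℕ} (A B : Set (EuclideanSpace ℝ (Fin n))) : Prop :=
  ∃ (t : EuclideanSpace ℝ (Fin n)) (c : ℝ), 0 < c ∧ A = (fun x => t + c • x) '' B

/-- The function `ϱ ↦ (α / ϱ^{n-1} + β ϱ^{n-1}) ∑_{i=0}^{n-1} ϱ^{n-1-2i}`. -/
noncomputable def phiObjective (α β : ℝ) (n : ℕ) (ϱ : ℝ) : ℝ :=
  (α / ϱ ^ (n - 1) + β * ϱ ^ (n - 1)) *
    ∑ i ∈ Finset.range n, ϱ ^ ((n : ℤ) - 1 - 2 * (i : ℤ))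

/-- `φ(α, β, n)`, the minimum over `ϱ > 0` of `phiObjective α β n`; see `phi_isLeast`. -/
noncomputable def phi (α β : ℝ) (n : ℕ) : ℝ :=
  sInf (phiObjective α β n '' Ioi 0)

/-- `ϱ₀(γ, n)`, the unique point of `(0, ∞)` where `phiObjective γ 1 n` attains its minimum;
for `γ = α / β` it is the unique minimum point of `phiObjective α β n`, see
`isMinOn_phiObjective_iff`. -/
noncomputable def rho0 (γ : ℝ) (n : ℕ) : ℝ :=
  Classical.epsilon fun ϱ : ℝ => 0 < ϱ ∧ IsMinOn (phiObjective γ 1 n) (Ioi 0) ϱ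

theorem phiObjective_eq_sum (α β : ℝ) (n : ℕ) {ϱ : ℝ} (h : 0 < ϱ) :
    phiObjective α β n ϱ = ∑ i ∈ Finset.range n,
      (α * ϱ ^ (-(2 * (i : ℤ))) + β * ϱ ^ (2 * ((n : ℤ) - 1 - (i : ℤ)))) := by
  rcases n with _ | m
  · simp [phiObjective]
  rw [phiObjective, Finset.mul_sum]
  refine Finset.sum_congr rfl fun i _ => ?_
  have e1 : ϱ ^ (((m + 1 : ℕ) : ℤ) - 1 - 2 * (i : ℤ)) = ϱ ^ m * ϱ ^ (-(2 * (i : ℤ))) := by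
    rw [← zpow_natCast, ← zpow_add₀ h.ne']
    congr 1
    push_cast
    ring
  have e2 : ϱ ^ (2 * (((m + 1 : ℕ) : ℤ) - 1 - (i : ℤ))) =
      ϱ ^ m * (ϱ ^ m * ϱ ^ (-(2 * (i : ℤ)))) := by
    rw [← zpow_natCast, ← zpow_add₀ h.ne', ← zpow_add₀ h.ne']
    congr 1
    push_cast
    ring
  rw [e1, e2, Nat.add_sub_cancel]
  have : ϱ ^ m ≠ 0 := by positivity
  field_simp

theorem continuousOn_phiObjective (α β : ℝ) (n : ℕ) :
    ContinuousOn (phiObjective α β n) (Ioi 0) := by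
  have h0 : ∀ x ∈ Ioi (0 : ℝ), x ≠ 0 := fun x hx => (mem_Ioi.1 hx).ne'
  unfold phiObjective
  refine ContinuousOn.mul (ContinuousOn.add (continuousOn_const.div (by fun_prop)
    fun x hx => pow_ne_zero _ (h0 x hx)) (by fun_prop)) (continuousOn_finsetSum _ fun i _ => ?_)
  exact continuousOn_id.zpow₀ _ fun x hx => Or.inl (h0 x hx)

theorem strictConvexOn_phiObjective {α β : ℝ} {n : ℕ} (hα : 0 < α) (hβ : 0 < β) (hn : 2 ≤ n) :
    StrictConvexOn ℝ (Ioi 0) (phiObjective α β n) := by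
  have hz : ∀ m : ℤ, ConvexOn ℝ (Ioi 0) fun x : ℝ => x ^ m := fun m => convexOn_zpow m
  have h1 : StrictConvexOn ℝ (Ioi 0) fun x : ℝ => α * x ^ (-(2 * ((1 : ℕ) : ℤ))) := by
    have := strictConvexOn_zpow (m := -(2 * ((1 : ℕ) : ℤ))) (by norm_num) (by norm_num)
    refine ⟨convex_Ioi 0, fun x hx y hy hxy a b ha hb hab => ?_⟩
    have h := mul_lt_mul_of_pos_left (this.2 hx hy hxy ha hb hab) hα
    simp only [smul_eq_mul] at h ⊢
    linarith
  have hterm : ∀ i : ℕ, ConvexOn ℝ (Ioi 0) fun x : ℝ =>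
      (α * x ^ (-(2 * (i : ℤ))) + β * x ^ (2 * ((n : ℤ) - 1 - (i : ℤ)))) := fun i =>
    ((hz _).smul hα.le).add ((hz _).smul hβ.le)
  have hrest : ∀ s : Finset ℕ, ConvexOn ℝ (Ioi 0) fun x : ℝ => ∑ i ∈ s,
      (α * x ^ (-(2 * (i : ℤ))) + β * x ^ (2 * ((n : ℤ) - 1 - (i : ℤ)))) := by
    intro s
    induction s using Finset.induction_on with
    | empty => simpa using convexOn_const (0 : ℝ) (convex_Ioi (0 : ℝ))
    | insert a s ha ih =>
      simp only [Finset.sum_insert ha]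
      exact (hterm a).add ih
  have htot := (h1.add_convexOn ((hz (2 * ((n : ℤ) - 1 - ((1 : ℕ) : ℤ)))).smul hβ.le)).add_convexOn
    (hrest ((Finset.range n).erase 1))
  refine htot.congr fun x hx => ?_
  rw [phiObjective_eq_sum α β n hx,
    ← Finset.add_sum_erase _ _ (Finset.mem_range.2 (by omega : 1 < n))]
  rfl

theorem phiObjective_ge {α β : ℝ} {n : ℕ} (hα : 0 < α) (hβ : 0 < β) (hn : 2 ≤ n) {ϱ : ℝ}
    (h : 0 < ϱ) : α * (ϱ ^ 2)⁻¹ ≤ phiObjective α β n ϱ ∧ β * ϱ ^ 2 ≤ phiObjective α β n ϱ := by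
  rw [phiObjective_eq_sum α β n h]
  have hnn : ∀ i ∈ Finset.range n,
      0 ≤ α * ϱ ^ (-(2 * (i : ℤ))) + β * ϱ ^ (2 * ((n : ℤ) - 1 - (i : ℤ))) :=
    fun i _ => by positivity
  constructor
  · refine le_trans ?_ (Finset.single_le_sum hnn (Finset.mem_range.2 (by omega : 1 < n)))
    have : ϱ ^ (-(2 * ((1 : ℕ) : ℤ))) = (ϱ ^ 2)⁻¹ := by
      rw [zpow_neg]
      norm_cast
    rw [this]
    exact le_add_of_nonneg_right (by positivity)
  · refine le_trans ?_ (Finset.single_le_sum hnn (Finset.mem_range.2 (by omega : n - 2 < n)))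
    have : ϱ ^ (2 * ((n : ℤ) - 1 - ((n - 2 : ℕ) : ℤ))) = ϱ ^ 2 := by
      have e : (2 * ((n : ℤ) - 1 - ((n - 2 : ℕ) : ℤ))) = ((2 : ℕ) : ℤ) := by omega
      rw [e, zpow_natCast]
    rw [this]
    exact le_add_of_nonneg_left (by positivity)

theorem exists_isMinOn_phiObjective {α β : ℝ} {n : ℕ} (hα : 0 < α) (hβ : 0 < β) (hn : 2 ≤ n) :
    ∃ ϱ : ℝ, 0 < ϱ ∧ IsMinOn (phiObjective α β n) (Ioi 0) ϱ := by
  set M := phiObjective α β n 1 with hM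
  obtain ⟨hM1, hM2⟩ := phiObjective_ge hα hβ hn one_pos
  rw [← hM] at hM1 hM2
  norm_num at hM1 hM2
  have hMpos : 0 < M := hα.trans_le hM1
  have ha : 0 < Real.sqrt (α / M) := Real.sqrt_pos.2 (by positivity)
  have hsub : Icc (Real.sqrt (α / M)) (Real.sqrt (M / β)) ⊆ Ioi 0 := fun x hx =>
    ha.trans_le hx.1
  have h1 : (1 : ℝ) ∈ Icc (Real.sqrt (α / M)) (Real.sqrt (M / β)) := by
    constructor
    · rw [Real.sqrt_le_one, div_le_one hMpos]
      exact hM1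
    · rw [Real.one_le_sqrt, one_le_div hβ]
      exact hM2
  obtain ⟨r, hr, hmin⟩ := isCompact_Icc.exists_isMinOn ⟨1, h1⟩
    ((continuousOn_phiObjective α β n).mono hsub)
  refine ⟨r, hsub hr, fun x hx => ?_⟩
  have hx0 : 0 < x := hx
  have hr1 : phiObjective α β n r ≤ M := hmin h1
  by_cases hxI : x ∈ Icc (Real.sqrt (α / M)) (Real.sqrt (M / β))
  · exact hmin hxI
  · refine hr1.trans ?_
    obtain ⟨g1, g2⟩ := phiObjective_ge hα hβ hn hx0
    rw [mem_Icc, not_and_or, not_le, not_le] at hxI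
    rcases hxI with hlt | hlt
    · refine le_trans ?_ g1
      have := (Real.lt_sqrt hx0.le).1 hlt
      rw [lt_div_iff₀ hMpos] at this
      rw [← div_eq_mul_inv, le_div_iff₀ (by positivity)]
      linarith
    · refine le_trans ?_ g2
      have := (Real.sqrt_lt' hx0).1 hlt
      rw [div_lt_iff₀ hβ] at this
      linarith

theorem phiObjective_scale (α : ℝ) {β : ℝ} (hβ : β ≠ 0) (n : ℕ) (ϱ : ℝ) :
    phiObjective α β n ϱ = β * phiObjective (α / β) 1 n ϱ := by
  unfold phiObjective
  rw [← mul_assoc]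
  congr 1
  field_simp

/-- The minimum is attained at exactly one positive point, namely at `ϱ₀(α / β, n)`. -/
theorem isMinOn_phiObjective_iff {α β : ℝ} {n : ℕ} (hα : 0 < α) (hβ : 0 < β) (hn : 2 ≤ n)
    (ϱ : ℝ) : (0 < ϱ ∧ IsMinOn (phiObjective α β n) (Ioi 0) ϱ) ↔ ϱ = rho0 (α / β) n := by
  have hs : 0 < rho0 (α / β) n ∧
      IsMinOn (phiObjective (α / β) 1 n) (Ioi 0) (rho0 (α / β) n) :=
    Classical.epsilon_spec (exists_isMinOn_phiObjective (div_pos hα hβ) one_pos hn)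
  have hs' : IsMinOn (phiObjective α β n) (Ioi 0) (rho0 (α / β) n) := by
    intro x hx
    simp only [mem_ofPred_eq, phiObjective_scale α hβ.ne']
    exact mul_le_mul_of_nonneg_left (hs.2 hx) hβ.le
  constructor
  · rintro ⟨h0, hm⟩
    exact (strictConvexOn_phiObjective hα hβ hn).eq_of_isMinOn hm hs' h0 hs.1
  · rintro rfl
    exact ⟨hs.1, hs'⟩

/-- `φ(α, β, n)` is an attained minimum. -/
theorem phi_isLeast {α β : ℝ} {n : ℕ} (hα : 0 < α) (hβ : 0 < β) (hn : 2 ≤ n) :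
    IsLeast (phiObjective α β n '' Ioi 0) (phi α β n) := by
  obtain ⟨r, hr, hm⟩ := exists_isMinOn_phiObjective hα hβ hn
  have : IsLeast (phiObjective α β n '' Ioi 0) (phiObjective α β n r) :=
    ⟨⟨r, hr, rfl⟩, by
      rintro _ ⟨x, hx, rfl⟩
      exact hm hx⟩
  rwa [phi, this.csInf_eq]

/-! Cut `K` by the hyperplanes orthogonal to `u`, at heights from `-h₂ = -h_K(-u)` to `h₁ = h_K(u)`.
The two extreme slices are the faces; write their volumes as `a ^ (n - 1)` and `b ^ (n - 1)`.
Relative interior points of a face with nonempty relative interior have `±u` as their only unit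
normal, so `α = h₁ a ^ (n - 1) / n` and `β = h₂ b ^ (n - 1) / n`. By Brunn–Minkowski the slice at
height `s` has at least the volume obtained by interpolating `a` and `b` affinely and raising to the
power `n - 1`. Integrating over `s` bounds `V(K)` below by `(h₁ + h₂) / n * ∑ a ^ (n - 1 - i) * b ^
i`, which is exactly the objective at `ϱ = √(a / b)` (`phiObjective_sqrt_div`,
`phiObjective_le_volume`). Hence `φ ≤ objective(ϱ) ≤ V(K) = 1`.

If `φ = 1`, then `ϱ` is the minimiser, which is the condition on `h₁ / h₂`. The lower bound also
applies to the convex hull of the two faces, since it has the same extreme slices; it therefore has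
volume 1 and equals `K`. Some intermediate slice then gives equality in Brunn–Minkowski, so the
faces are homothetic. Conversely, every slice of the hull of two homothetic faces lies in a
homothetic copy of one face, which bounds the volume above by the same quantity.

Brunn–Minkowski follows from Prékopa–Leindler. Its equality case compares half-space cuts: for each
linear functional the two normalised bodies have the same distribution up to a shift, so by
characteristic functions they are translates. -/

open scoped ENNReal NNReal Pointwise

/-! ### The Prékopa–Leindler inequality. -/

theorem ENNReal.geom_mean_le_arith_mean {p q : ℝ} (hp : 0 < p) (hq : 0 < q) (hpq : p + q = 1)
    (x y : ℝ≥0∞) : x ^ p * y ^ q ≤ ENNReal.ofReal p * x + ENNReal.ofReal q * y := by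
  rcases eq_or_ne x ⊤ with rfl | hx
  · simp [ENNReal.mul_top, hp]
  rcases eq_or_ne y ⊤ with rfl | hy
  · simp [ENNReal.mul_top, hq]
  lift x to ℝ≥0 using hx
  lift y to ℝ≥0 using hy
  have := NNReal.geom_mean_le_arith_mean2_weighted p.toNNReal q.toNNReal x y
    (by rw [← Real.toNNReal_add hp.le hq.le, hpq, Real.toNNReal_one])
  rw [Real.coe_toNNReal _ hp.le, Real.coe_toNNReal _ hq.le] at this
  rw [← ENNReal.coe_rpow_of_nonneg _ hp.le, ← ENNReal.coe_rpow_of_nonneg _ hq.le,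
    ENNReal.ofReal, ENNReal.ofReal]
  exact_mod_cast this

/-- The translate `A + min B` lies to the left of `max A + min B` and `max A + B` lies to its right.
Both lie in `C` and they meet in a single point. -/
theorem Real.volume_add_le_of_isCompact {A B C : Set ℝ} (hA : IsCompact A) (hB : IsCompact B)
    (hA0 : A.Nonempty) (hB0 : B.Nonempty) (h : ∀ a ∈ A, ∀ b ∈ B, a + b ∈ C) :
    volume A + volume B ≤ volume C := by
  have hM := hA.sSup_mem hA0
  have hm := hB.sInf_mem hB0
  rw [← measure_inter_add_sdiff C (measurableSet_Iic (a := sSup A + sInf B))]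
  refine add_le_add ?_ ?_
  · rw [← measure_preimage_add_right volume (sInf B)
      (C ∩ Iic (sSup A + sInf B))]
    exact measure_mono fun a ha => ⟨h a ha _ hm, by
      simpa using le_csSup hA.bddAbove ha⟩
  · rw [← measure_preimage_add volume (sSup A) (C \ Iic (sSup A + sInf B)),
      ← measure_sdiff_null (s := B) (measure_singleton (sInf B))]
    refine measure_mono fun b hb => ⟨h _ hM b hb.1, ?_⟩
    have h1 := csInf_le hB.bddBelow hb.1
    have h2 : sInf B < b := lt_of_le_of_ne h1 (Ne.symm hb.2)
    simpa using h2

theorem Real.volume_add_le {A B C : Set ℝ} (hA : MeasurableSet A) (hB : MeasurableSet B)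
    (hA0 : A.Nonempty) (hB0 : B.Nonempty) (h : ∀ a ∈ A, ∀ b ∈ B, a + b ∈ C) :
    volume A + volume B ≤ volume C := by
  obtain ⟨x, hx⟩ := hA0
  obtain ⟨y, hy⟩ := hB0
  have key : ∀ K ⊆ A, IsCompact K → ∀ K' ⊆ B, IsCompact K' →
      volume K + volume K' ≤ volume C := by
    intro K hKA hK K' hKB hK'
    -- Adjoining the fixed points `x` and `y` keeps the compact approximations nonempty.
    have := Real.volume_add_le_of_isCompact (hK.insert x) (hK'.insert y) (insert_nonempty _ _)
      (insert_nonempty _ _) (C := C) fun a ha b hb =>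
        h a (insert_subset hx hKA ha) b (insert_subset hy hKB hb)
    exact le_trans (add_le_add (measure_mono (subset_insert _ _))
      (measure_mono (subset_insert _ _))) this
  have e : ∀ A : Set ℝ, MeasurableSet A →
      volume A = ⨆ K ∈ {K | K ⊆ A ∧ IsCompact K}, volume K := by
    intro A hA
    simp only [hA.measure_eq_iSup_isCompact, mem_ofPred_eq, iSup_and]
  rw [e A hA, e B hB]
  have h0 : ∀ A : Set ℝ, {K | K ⊆ A ∧ IsCompact K}.Nonempty := fun A =>
    ⟨∅, empty_subset _, isCompact_empty⟩
  exact ENNReal.biSup_add_biSup_le (h0 A) (h0 B) fun K hK K' hK' => key K hK.1 hK.2 K' hK'.1 hK'.2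

/-- The Prékopa–Leindler inequality holds on the measured vector space `E`. -/
def PrekopaLeindler (E : Type*) [AddCommGroup E] [Module ℝ E] [MeasureSpace E] : Prop :=
  ∀ ⦃p q : ℝ⦄, 0 < p → 0 < q → p + q = 1 → ∀ ⦃f g h : E → ℝ≥0∞⦄,
    Measurable f → Measurable g → Measurable h →
    (∀ x y, f x ^ p * g y ^ q ≤ h (p • x + q • y)) →
    (∫⁻ x, f x) ^ p * (∫⁻ x, g x) ^ q ≤ ∫⁻ x, h x

theorem lintegral_eq_lintegral_superlevel {f : ℝ → ℝ≥0∞} (hf : Measurable f)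
    (h1 : ∀ x, f x ≤ 1) :
    ∫⁻ x, f x = ∫⁻ t in Ioi (0 : ℝ), volume {x | ENNReal.ofReal t < f x} := by
  have hne : ∀ x, f x ≠ ⊤ := fun x => ne_top_of_le_ne_top ENNReal.one_ne_top (h1 x)
  have := lintegral_eq_lintegral_meas_lt volume (f := fun x => (f x).toReal)
    (Filter.Eventually.of_forall fun x => ENNReal.toReal_nonneg) hf.ennreal_toReal.aemeasurable
  simp only [ENNReal.ofReal_toReal (hne _)] at this
  rw [this]
  refine setLIntegral_congr_fun measurableSet_Ioi fun t ht => ?_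
  simp only [ENNReal.ofReal_lt_iff_lt_toReal (mem_Ioi.1 ht).le (hne _)]

/-- With both suprema equal to 1, the sets `{f > t}` and `{g > t}` are nonempty for every `t < 1`,
and their weighted sum lies in `{h > t}`. The one-dimensional sumset bound, integrated over `t`,
gives even the arithmetic mean on the left. -/
theorem prekopaLeindler_real_of_iSup_eq_one {p q : ℝ} (hp : 0 < p) (hq : 0 < q) (hpq : p + q = 1)
    {f g h : ℝ → ℝ≥0∞} (hf : Measurable f) (hg : Measurable g) (hh : Measurable h)
    (hfgh : ∀ x y, f x ^ p * g y ^ q ≤ h (p • x + q • y))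
    (hf1 : ⨆ x, f x = 1) (hg1 : ⨆ x, g x = 1) :
    (∫⁻ x, f x) ^ p * (∫⁻ x, g x) ^ q ≤ ∫⁻ x, h x := by
  refine (ENNReal.geom_mean_le_arith_mean hp hq hpq _ _).trans ?_
  have hfle : ∀ x, f x ≤ 1 := fun x => hf1 ▸ le_iSup f x
  have hgle : ∀ x, g x ≤ 1 := fun x => hg1 ▸ le_iSup g x
  have hmeas : ∀ f : ℝ → ℝ≥0∞, Measurable fun t : ℝ => volume {x | ENNReal.ofReal t < f x} := by
    intro f
    refine Antitone.measurable fun s t hst => measure_mono fun x hx => ?_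
    exact (ENNReal.ofReal_le_ofReal hst).trans_lt hx
  -- Only levels `t < 1` matter, so `h` may be cut off at 1, as the layer-cake formula requires.
  refine le_trans ?_ (lintegral_mono (f := fun x => min (h x) 1) fun x => min_le_left _ _)
  rw [lintegral_eq_lintegral_superlevel hf hfle, lintegral_eq_lintegral_superlevel hg hgle,
    lintegral_eq_lintegral_superlevel (hh.min measurable_const) fun x => min_le_right _ _,
    ← lintegral_const_mul _ (hmeas f), ← lintegral_const_mul _ (hmeas g),
    ← lintegral_add_left ((hmeas f).const_mul _)]
  refine setLIntegral_mono' measurableSet_Ioi fun t ht => ?_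
  have ht0 : 0 < t := ht
  rcases lt_or_ge t 1 with ht1 | ht1
  · have ht1' : ENNReal.ofReal t < 1 := by simpa using ht1
    have e : ∀ c : ℝ, 0 < c → ∀ A : Set ℝ, ENNReal.ofReal c * volume A = volume (c • A) := by
      intro c hc A
      rw [Measure.addHaar_smul]
      simp [abs_of_pos hc]
    rw [e p hp, e q hq]
    have hnf : {x | ENNReal.ofReal t < f x}.Nonempty := by
      have := hf1 ▸ ht1'
      exact lt_iSup_iff.1 this
    have hng : {x | ENNReal.ofReal t < g x}.Nonempty := by
      have := hg1 ▸ ht1'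
      exact lt_iSup_iff.1 this
    refine Real.volume_add_le ((measurableSet_lt measurable_const hf).const_smul₀ p)
      ((measurableSet_lt measurable_const hg).const_smul₀ q) (hnf.smul_set) (hng.smul_set) ?_
    rintro _ ⟨x, hx, rfl⟩ _ ⟨y, hy, rfl⟩
    refine lt_min ?_ ht1'
    refine lt_of_lt_of_le ?_ (hfgh x y)
    have : ENNReal.ofReal t = ENNReal.ofReal t ^ p * ENNReal.ofReal t ^ q := by
      rw [← ENNReal.rpow_add _ _ (by simpa using ht0) ENNReal.ofReal_ne_top, hpq, ENNReal.rpow_one]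
    rw [this]
    exact ENNReal.mul_lt_mul (ENNReal.rpow_lt_rpow hx hp) (ENNReal.rpow_lt_rpow hy hq)
  · have h1 : (1 : ℝ≥0∞) ≤ ENNReal.ofReal t := by simpa using ht1
    have e : ∀ f : ℝ → ℝ≥0∞, (∀ x, f x ≤ 1) → {x | ENNReal.ofReal t < f x} = ∅ := by
      intro f hf
      ext x
      simpa using (hf x).trans h1
    simp [e f hfle, e g hgle]

/-- By homogeneity, `f` and `g` are divided by their suprema `M`, `N` and `h` by `M ^ p * N ^ q`. -/
theorem prekopaLeindler_real_of_iSup_ne_top {p q : ℝ} (hp : 0 < p) (hq : 0 < q) (hpq : p + q = 1)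
    {f g h : ℝ → ℝ≥0∞} (hf : Measurable f) (hg : Measurable g) (hh : Measurable h)
    (hfgh : ∀ x y, f x ^ p * g y ^ q ≤ h (p • x + q • y))
    (hf1 : ⨆ x, f x ≠ ⊤) (hg1 : ⨆ x, g x ≠ ⊤) :
    (∫⁻ x, f x) ^ p * (∫⁻ x, g x) ^ q ≤ ∫⁻ x, h x := by
  rcases eq_or_ne (⨆ x, f x) 0 with hf0 | hf0
  · have : ∀ x, f x = 0 := by simpa [ENNReal.iSup_eq_zero] using hf0
    simp [this, hp]
  rcases eq_or_ne (⨆ x, g x) 0 with hg0 | hg0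
  · have : ∀ x, g x = 0 := by simpa [ENNReal.iSup_eq_zero] using hg0
    simp [this, hq]
  set M := ⨆ x, f x
  set N := ⨆ x, g x
  have hM0 : M ^ p ≠ 0 := by simp [hf0, hf1]
  have hN0 : N ^ q ≠ 0 := by simp [hg0, hg1]
  have hM1 : M ^ p ≠ ⊤ := ENNReal.rpow_ne_top_of_nonneg hp.le hf1
  have hN1 : N ^ q ≠ ⊤ := ENNReal.rpow_ne_top_of_nonneg hq.le hg1
  have key := prekopaLeindler_real_of_iSup_eq_one hp hq hpq
    (hf.mul_const M⁻¹) (hg.mul_const N⁻¹) (hh.mul_const ((M ^ p)⁻¹ * (N ^ q)⁻¹)) ?_ ?_ ?_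
  · rw [lintegral_mul_const _ hf, lintegral_mul_const _ hg, lintegral_mul_const _ hh,
      ENNReal.mul_rpow_of_nonneg _ _ hp.le, ENNReal.mul_rpow_of_nonneg _ _ hq.le,
      ENNReal.inv_rpow, ENNReal.inv_rpow, mul_mul_mul_comm] at key
    refine (ENNReal.mul_le_mul_iff_left ?_ ?_).1 key
    · simp only [ne_eq, mul_eq_zero, ENNReal.inv_eq_zero]
      tauto
    · exact ENNReal.mul_ne_top (ENNReal.inv_ne_top.2 hM0) (ENNReal.inv_ne_top.2 hN0)
  · intro x y
    rw [ENNReal.mul_rpow_of_nonneg _ _ hp.le, ENNReal.mul_rpow_of_nonneg _ _ hq.le,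
      ENNReal.inv_rpow, ENNReal.inv_rpow, mul_mul_mul_comm]
    exact mul_le_mul_left (hfgh x y) _
  · rw [← ENNReal.iSup_mul, ENNReal.mul_inv_cancel hf0 hf1]
  · rw [← ENNReal.iSup_mul, ENNReal.mul_inv_cancel hg0 hg1]

theorem lintegral_eq_iSup_lintegral_min {f : ℝ → ℝ≥0∞} (hf : Measurable f) :
    ∫⁻ x, f x = ⨆ N : ℕ, ∫⁻ x, min (f x) N := by
  rw [← lintegral_iSup fun N => hf.min measurable_const]
  · congr 1
    ext x
    refine le_antisymm ?_ (iSup_le fun N => min_le_left _ _)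
    rcases eq_or_ne (f x) ⊤ with hx | hx
    · simp [hx, ENNReal.iSup_natCast]
    · obtain ⟨N, hN⟩ := ENNReal.exists_nat_gt hx
      exact le_iSup_of_le N (by rw [min_eq_left hN.le])
  · intro M N hMN x
    exact min_le_min le_rfl (by exact_mod_cast hMN)

theorem prekopaLeindler_real : PrekopaLeindler ℝ := by
  intro p q hp hq hpq f g h hf hg hh hfgh
  have hsup : ∀ (f : ℝ → ℝ≥0∞) (N : ℕ), ⨆ x, min (f x) (N : ℝ≥0∞) ≠ ⊤ := fun f N =>
    ne_top_of_le_ne_top (ENNReal.natCast_ne_top N) (iSup_le fun x => min_le_right _ _)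
  have key : ∀ N : ℕ, (∫⁻ x, min (f x) N) ^ p * (∫⁻ x, min (g x) N) ^ q ≤ ∫⁻ x, h x := by
    intro N
    refine prekopaLeindler_real_of_iSup_ne_top hp hq hpq (hf.min measurable_const)
      (hg.min measurable_const) hh (fun x y => le_trans ?_ (hfgh x y)) (hsup f N) (hsup g N)
    exact mul_le_mul' (ENNReal.rpow_le_rpow (min_le_left _ _) hp.le)
      (ENNReal.rpow_le_rpow (min_le_left _ _) hq.le)
  have hmono : ∀ f : ℝ → ℝ≥0∞, Monotone fun N : ℕ => ∫⁻ x, min (f x) N := by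
    intro f M N hMN
    exact lintegral_mono fun x => min_le_min le_rfl (by exact_mod_cast hMN)
  rw [lintegral_eq_iSup_lintegral_min hf, lintegral_eq_iSup_lintegral_min hg]
  have e : ∀ {p : ℝ}, 0 < p → ∀ a : ℕ → ℝ≥0∞, (⨆ N, a N) ^ p = ⨆ N, a N ^ p := fun hp a =>
    (ENNReal.orderIsoRpow _ hp).map_iSup a
  rw [e hp, e hq]
  rw [ENNReal.iSup_mul]
  refine iSup_le fun M => ?_
  rw [ENNReal.mul_iSup]
  refine iSup_le fun N => ?_
  refine le_trans ?_ (key (max M N))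
  exact mul_le_mul' (ENNReal.rpow_le_rpow (hmono f (le_max_left _ _)) hp.le)
    (ENNReal.rpow_le_rpow (hmono g (le_max_right _ _)) hq.le)

/-- The inequality on the fibres `F` says that the fibre integrals of `f`, `g`, `h` satisfy the
hypothesis on `E`; Tonelli does the rest. -/
theorem PrekopaLeindler.prod {E F : Type*} [AddCommGroup E] [Module ℝ E] [MeasureSpace E]
    [AddCommGroup F] [Module ℝ F] [MeasureSpace F] [SFinite (volume : Measure F)]
    [SFinite (volume : Measure E)]
    (hE : PrekopaLeindler E) (hF : PrekopaLeindler F) : PrekopaLeindler (E × F) := by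
  intro p q hp hq hpq f g h hf hg hh hfgh
  simp only [Measure.volume_eq_prod]
  rw [lintegral_prod _ hf.aemeasurable, lintegral_prod _ hg.aemeasurable,
    lintegral_prod _ hh.aemeasurable]
  refine hE hp hq hpq hf.lintegral_prod_right' hg.lintegral_prod_right' hh.lintegral_prod_right'
    fun x y => ?_
  exact hF hp hq hpq (hf.comp measurable_prodMk_left) (hg.comp measurable_prodMk_left)
    (hh.comp measurable_prodMk_left) fun x' y' => hfgh (x, x') (y, y')

theorem PrekopaLeindler.of_measurePreserving {E F : Type*} [AddCommGroup E] [Module ℝ E]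
    [MeasureSpace E] [AddCommGroup F] [Module ℝ F] [MeasureSpace F] (hE : PrekopaLeindler E)
    {φ : E → F} (hφ : MeasurePreserving φ) (hadd : ∀ x y, φ (x + y) = φ x + φ y)
    (hsmul : ∀ (c : ℝ) x, φ (c • x) = c • φ x) : PrekopaLeindler F := by
  intro p q hp hq hpq f g h hf hg hh hfgh
  rw [← hφ.lintegral_comp hf, ← hφ.lintegral_comp hg, ← hφ.lintegral_comp hh]
  refine hE hp hq hpq (hf.comp hφ.measurable) (hg.comp hφ.measurable) (hh.comp hφ.measurable)
    fun x y => ?_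
  simpa [hadd, hsmul] using hfgh (φ x) (φ y)

theorem prekopaLeindler_pi (d : ℕ) : PrekopaLeindler (Fin d → ℝ) := by
  induction d with
  | zero =>
    intro p q hp hq hpq f g h hf hg hh hfgh
    have e : (volume : Measure (Fin 0 → ℝ)) univ = 1 := by
      rw [Measure.volume_pi_eq_dirac 0]
      simp
    simp only [lintegral_unique, e, mul_one]
    convert hfgh default default using 4
  | succ d ih =>
    refine (prekopaLeindler_real.prod ih).of_measurePreserving
      (volume_preserving_piFinSuccAbove (fun _ : Fin (d + 1) => ℝ) 0).symm ?_ ?_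
    · intro x y
      ext i
      refine Fin.cases ?_ (fun j => ?_) i <;> rfl
    · intro x y
      ext i
      refine Fin.cases ?_ (fun j => ?_) i <;> rfl

theorem prekopaLeindler_euclideanSpace (d : ℕ) : PrekopaLeindler (EuclideanSpace ℝ (Fin d)) :=
  (prekopaLeindler_pi d).of_measurePreserving (PiLp.volume_preserving_toLp (Fin d))
    (fun _ _ => rfl) (fun _ _ => rfl)

/-! ### Brunn–Minkowski and cuts by half-spaces. -/

section BrunnMinkowski

set_option linter.unusedSectionVars false

variable {V : Type*} [NormedAddCommGroup V] [NormedSpace ℝ V] [FiniteDimensional ℝ V]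
  [MeasureSpace V] [BorelSpace V] [(volume : Measure V).IsAddHaarMeasure]

open Module

/-- The Brunn–Minkowski inequality. -/
theorem PrekopaLeindler.brunnMinkowski (hV : PrekopaLeindler V) {A B C : Set V}
    (hA : MeasurableSet A) (hB : MeasurableSet B) (hC : MeasurableSet C) (hCfin : volume C ≠ ⊤)
    {a b p q : ℝ} (ha : 0 < a) (hb : 0 < b) (hp : 0 < p) (hq : 0 < q)
    (hAa : volume.real A = a ^ finrank ℝ V) (hBb : volume.real B = b ^ finrank ℝ V)
    (h : ∀ x ∈ A, ∀ y ∈ B, p • x + q • y ∈ C) :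
    (p * a + q * b) ^ finrank ℝ V ≤ volume.real C := by
  set d := finrank ℝ V
  set e := p * a + q * b with he
  have hepos : 0 < e := by positivity
  have hlin : ∀ {c : ℝ}, 0 < c → ∀ {S : Set V}, MeasurableSet S →
      ∫⁻ x, indicator S (1 : V → ℝ≥0∞) (c • x) = ENNReal.ofReal ((c ^ d)⁻¹) * volume S := by
    intro c hc S hS
    have e1 : (fun x => indicator S (1 : V → ℝ≥0∞) (c • x)) =
        indicator ((fun x => c • x) ⁻¹' S) 1 := by
      rfl
    rw [e1, lintegral_indicator_one (measurable_const_smul c hS),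
      Measure.addHaar_preimage_smul _ hc.ne', abs_of_pos (by positivity)]
  have hone : ∀ {c : ℝ}, 0 < c → ∀ {S : Set V}, volume.real S = c ^ d →
      ENNReal.ofReal ((c ^ d)⁻¹) * volume S = 1 := by
    intro c hc S hS
    have hpos : 0 < c ^ d := by positivity
    have hfin : volume S ≠ ⊤ := by
      intro h
      rw [measureReal_def, h, ENNReal.toReal_top] at hS
      exact hpos.ne hS
    rw [← ENNReal.ofReal_toReal hfin, ← measureReal_def, hS,
      ← ENNReal.ofReal_mul (by positivity), inv_mul_cancel₀ hpos.ne', ENNReal.ofReal_one]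
  have hmeas : ∀ (c : ℝ) {S : Set V}, MeasurableSet S →
      Measurable fun x => indicator S (1 : V → ℝ≥0∞) (c • x) := fun c S hS =>
    (measurable_one.indicator hS).comp (measurable_const_smul c)
  -- The sets `A / a` and `B / b` have volume 1, and their combination with weights `p a / e`, `q b
  -- / e` lies in `C / e`. Applied to indicators, Prékopa–Leindler gives `1 ≤ vol (C / e)`.
  have key := hV (p := p * a / e) (q := q * b / e) (by positivity) (by positivity)
    (by rw [← add_div, div_self hepos.ne']) (hmeas a hA) (hmeas b hB) (hmeas e hC) ?_
  · rw [hlin ha hA, hlin hb hB, hlin hepos hC, hone ha hAa, hone hb hBb, ENNReal.one_rpow,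
      ENNReal.one_rpow, one_mul, ← ENNReal.ofReal_toReal hCfin, ← measureReal_def,
      ← ENNReal.ofReal_mul (by positivity), ENNReal.one_le_ofReal, ← div_eq_inv_mul,
      one_le_div (by positivity)] at key
    exact key
  · intro x y
    by_cases hx : a • x ∈ A
    · by_cases hy : b • y ∈ B
      · have hz : e • ((p * a / e) • x + (q * b / e) • y) ∈ C := by
          have := h _ hx _ hy
          convert! this using 1
          rw [smul_add, smul_smul, smul_smul, smul_smul, smul_smul, mul_div_cancel₀ _ hepos.ne',
            mul_div_cancel₀ _ hepos.ne']
        rw [indicator_of_mem hx, indicator_of_mem hy, indicator_of_mem hz]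
        simp
      · have : 0 < q * b / e := by positivity
        simp [hy, this]
    · have : 0 < p * a / e := by positivity
      simp [hx, this]

theorem Convex.interior_nonempty_of_volume_pos {A : Set V}
    (hA : Convex ℝ A) (h : volume A ≠ 0) : (interior A).Nonempty := by
  rw [nonempty_iff_ne_empty]
  intro h0
  apply h
  refine measure_mono_null (subset_closure) ?_
  have := hA.addHaar_frontier volume
  rwa [frontier, h0, sdiff_empty] at this

/-- The open set `interior A \ D` is null, hence empty, and `A` lies in the closure of its interior.
-/
theorem Convex.subset_of_volume_sdiff_eq_zero {A D : Set V} (hA : Convex ℝ A)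
    (hA0 : (interior A).Nonempty) (hD : IsClosed D) (h : volume (A \ D) = 0) : A ⊆ D := by
  have h1 : interior A ⊆ D := by
    rw [← sdiff_eq_empty, ← (isOpen_interior.sdiff hD).measure_eq_zero_iff volume]
    exact measure_mono_null (sdiff_subset_sdiff_left interior_subset) h
  calc A ⊆ closure A := subset_closure
    _ = closure (interior A) := (hA.closure_interior_eq_closure_of_nonempty_interior hA0).symm
    _ ⊆ D := closure_minimal h1 hD

/-- The volume of the part of `A` where the functional `f` is at most `s`. -/
noncomputable def sublevelVolume (A : Set V) (f : V →L[ℝ] ℝ) (s : ℝ) : ℝ :=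
  volume.real (A ∩ f ⁻¹' Iic s)

theorem sublevelVolume_mono {A : Set V} (hA : IsCompact A) (f : V →L[ℝ] ℝ) :
    Monotone (sublevelVolume A f) := fun _ _ hst =>
  measureReal_mono (inter_subset_inter_right _ (preimage_mono (Iic_subset_Iic.2 hst)))
    (measure_ne_top_of_subset inter_subset_left hA.measure_ne_top)

theorem sublevelVolume_le {A : Set V} (hA : IsCompact A) (f : V →L[ℝ] ℝ) (s : ℝ) :
    sublevelVolume A f s ≤ volume.real A :=
  measureReal_mono inter_subset_left hA.measure_ne_top

theorem exists_sublevelVolume_eq_zero {A : Set V} (hA : IsCompact A) (f : V →L[ℝ] ℝ) :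
    ∃ s, sublevelVolume A f s = 0 := by
  obtain ⟨m, hm⟩ := (hA.image f.continuous).bddBelow
  refine ⟨m - 1, ?_⟩
  have : A ∩ f ⁻¹' Iic (m - 1) = ∅ := by
    ext x
    simp only [mem_inter_iff, mem_preimage, mem_Iic, mem_empty_iff_false, iff_false, not_and,
      not_le]
    intro hx
    have := hm (mem_image_of_mem f hx)
    linarith
  simp [sublevelVolume, this]

theorem exists_sublevelVolume_eq {A : Set V} (hA : IsCompact A) (f : V →L[ℝ] ℝ) :
    ∃ s, ∀ t, s ≤ t → sublevelVolume A f t = volume.real A := by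
  obtain ⟨m, hm⟩ := (hA.image f.continuous).bddAbove
  refine ⟨m, fun t ht => ?_⟩
  rw [sublevelVolume, inter_eq_left.2]
  exact fun x hx => (hm (mem_image_of_mem f hx)).trans ht

theorem volume_preimage_singleton {f : V →L[ℝ] ℝ} (hf : f ≠ 0) (s : ℝ) :
    volume (f ⁻¹' {s}) = 0 := by
  obtain ⟨v, hv⟩ : ∃ v, f v ≠ 0 := by
    by_contra! h
    exact hf (ContinuousLinearMap.ext h)
  rcases (f ⁻¹' {s}).eq_empty_or_nonempty with h0 | ⟨x, hx⟩
  · rw [h0, measure_empty]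
  have hx : f x = s := hx
  have h1 := Measure.addHaar_submodule (volume : Measure V) f.ker fun h => hv (by
    have : v ∈ f.ker := h ▸ Submodule.mem_top
    exact this)
  rw [← measure_preimage_add_right volume x]
  refine measure_mono_null (fun y hy => ?_) h1
  have hy : f (y + x) = s := hy
  rw [map_add, hx] at hy
  show f y = 0
  linarith

/-- Hyperplanes are null, so the image under `f` of the volume on `A` has no atoms. -/
theorem continuous_sublevelVolume {A : Set V} (hA : IsCompact A) {f : V →L[ℝ] ℝ} (hf : f ≠ 0) :
    Continuous (sublevelVolume A f) := by
  have : IsFiniteMeasure (volume.restrict A) := ⟨by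
    rw [Measure.restrict_apply_univ]
    exact hA.measure_lt_top⟩
  set ν : Measure ℝ := (volume.restrict A).map f
  have hν : ∀ s, MeasurableSet s → ν s = volume (A ∩ f ⁻¹' s) := by
    intro s hs
    rw [Measure.map_apply f.continuous.measurable hs,
      Measure.restrict_apply (f.continuous.measurable hs), inter_comm]
  have : NullSingletonClass ν := ⟨fun s => by
    rw [hν _ (measurableSet_singleton s)]
    exact measure_mono_null inter_subset_right (volume_preimage_singleton hf s)⟩
  obtain ⟨m, hm⟩ := exists_sublevelVolume_eq_zero hA f
  have hc : Continuous fun s => ∫ _ in m..s, (1 : ℝ) ∂ν :=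
    intervalIntegral.continuous_primitive (fun a b => intervalIntegrable_const) m
  have hw : ∀ s, sublevelVolume A f s = ν.real (Iic s) := fun s => by
    rw [sublevelVolume, measureReal_def, measureReal_def, hν _ measurableSet_Iic]
  refine hc.congr fun s => ?_
  have := intervalIntegral.integral_Iic_sub_Iic (μ := ν) (f := fun _ => (1 : ℝ)) (a := m) (b := s)
    (integrable_const _).integrableOn (integrable_const _).integrableOn
  rw [← this]
  simp [← hw, hm]

theorem exists_sublevelVolume_eq_of_mem_Ioo {A : Set V} (hA : IsCompact A) {f : V →L[ℝ] ℝ}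
    (hf : f ≠ 0) {τ : ℝ} (hτ : τ ∈ Ioo 0 (volume.real A)) : ∃ s, sublevelVolume A f s = τ := by
  obtain ⟨m, hm⟩ := exists_sublevelVolume_eq_zero hA f
  obtain ⟨M, hM⟩ := exists_sublevelVolume_eq hA f
  exact mem_range_of_exists_le_of_exists_ge (continuous_sublevelVolume hA hf)
    ⟨m, by rw [hm]; exact hτ.1.le⟩ ⟨M, by rw [hM M le_rfl]; exact hτ.2.le⟩

theorem volume_inter_Ici {A : Set V} (hA : IsCompact A) {f : V →L[ℝ] ℝ} (hf : f ≠ 0) (s : ℝ) :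
    volume.real (A ∩ f ⁻¹' Ici s) = volume.real A - sublevelVolume A f s := by
  have h1 : volume.real (A ∩ f ⁻¹' Ici s) = volume.real (A \ f ⁻¹' Iic s) := by
    apply le_antisymm
    · rw [measureReal_def, measureReal_def]
      apply ENNReal.toReal_mono (measure_ne_top_of_subset sdiff_subset hA.measure_ne_top)
      have : A ∩ f ⁻¹' Ici s ⊆ (A \ f ⁻¹' Iic s) ∪ f ⁻¹' {s} := by
        rintro x ⟨hx, hxs⟩
        rcases eq_or_lt_of_le (show s ≤ f x from hxs) with h | h
        · exact Or.inr h.symm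
        · exact Or.inl ⟨hx, not_le.2 h⟩
      refine (measure_mono this).trans ((measure_union_le _ _).trans ?_)
      rw [volume_preimage_singleton hf, add_zero]
    · refine measureReal_mono (fun x hx => ⟨hx.1, (not_le.1 (show ¬ f x ≤ s from hx.2)).le⟩)
        (measure_ne_top_of_subset inter_subset_left hA.measure_ne_top)
  rw [h1, sublevelVolume, eq_sub_iff_add_eq', measureReal_inter_add_sdiff
    (f.continuous.measurable measurableSet_Iic) hA.measure_ne_top]

section Cuts

variable {A B C : Set V} {p q : ℝ} {f : V →L[ℝ] ℝ}

theorem le_sublevelVolume (hV : PrekopaLeindler V) (hA : IsCompact A) (hB : IsCompact B)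
    (hC : IsCompact C) (hp : 0 < p) (hq : 0 < q) (h : ∀ x ∈ A, ∀ y ∈ B, p • x + q • y ∈ C)
    {r r' s s' : ℝ} (hr : 0 < r) (hr' : 0 < r')
    (hs : sublevelVolume A f s = r ^ finrank ℝ V)
    (hs' : sublevelVolume B f s' = r' ^ finrank ℝ V) :
    (p * r + q * r') ^ finrank ℝ V ≤ sublevelVolume C f (p * s + q * s') := by
  have hm : ∀ t, MeasurableSet (f ⁻¹' Iic t) := fun t => f.continuous.measurable measurableSet_Iic
  refine hV.brunnMinkowski (hA.measurableSet.inter (hm s)) (hB.measurableSet.inter (hm s'))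
    (hC.measurableSet.inter (hm _)) (measure_ne_top_of_subset inter_subset_left hC.measure_ne_top)
    hr hr' hp hq hs hs' fun x hx y hy => ⟨h x hx.1 y hy.1, ?_⟩
  have h1 : f x ≤ s := hx.2
  have h2 : f y ≤ s' := hy.2
  simp only [mem_preimage, map_add, map_smul, smul_eq_mul, mem_Iic]
  gcongr

/-- Brunn–Minkowski for the upper parts gives `C` at least `1 - τ` above the combined height; as `C`
has volume at most 1, at most `τ` remains below. -/
theorem sublevelVolume_le_of_volume_le (hV : PrekopaLeindler V) (hd : 0 < finrank ℝ V)
    (hf : f ≠ 0) (hA : IsCompact A)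
    (hB : IsCompact B) (hC : IsCompact C) (hp : 0 < p) (hq : 0 < q) (hpq : p + q = 1)
    (h : ∀ x ∈ A, ∀ y ∈ B, p • x + q • y ∈ C)
    (hA1 : volume.real A = 1) (hB1 : volume.real B = 1) (hC1 : volume.real C ≤ 1)
    {τ s s' : ℝ} (hτ : τ < 1) (hs : sublevelVolume A f s = τ) (hs' : sublevelVolume B f s' = τ) :
    sublevelVolume C f (p * s + q * s') ≤ τ := by
  have hm : ∀ t, MeasurableSet (f ⁻¹' Ici t) := fun t => f.continuous.measurable measurableSet_Ici
  set t : ℝ := (1 - τ) ^ ((finrank ℝ V : ℝ)⁻¹)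
  have ht : 0 < t := Real.rpow_pos_of_pos (by linarith) _
  have htd : t ^ finrank ℝ V = 1 - τ := Real.rpow_inv_natCast_pow (by linarith) hd.ne'
  have key := hV.brunnMinkowski (hA.measurableSet.inter (hm s)) (hB.measurableSet.inter (hm s'))
    (hC.measurableSet.inter (hm (p * s + q * s')))
    (measure_ne_top_of_subset inter_subset_left hC.measure_ne_top)
    ht ht hp hq (by rw [volume_inter_Ici hA hf, hA1, hs, htd])
    (by rw [volume_inter_Ici hB hf, hB1, hs', htd]) fun x hx y hy => ⟨h x hx.1 y hy.1, ?_⟩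
  · rw [← add_mul, hpq, one_mul, htd, volume_inter_Ici hC hf] at key
    linarith
  · have h1 : s ≤ f x := hx.2
    have h2 : s' ≤ f y := hy.2
    simp only [mem_preimage, map_add, map_smul, smul_eq_mul, mem_Ici]
    gcongr

/-- By Brunn–Minkowski inside `C`, the root of the volume below a height is concave where positive,
so it keeps growing strictly until it reaches its maximum. -/
theorem sublevelVolume_lt (hV : PrekopaLeindler V) (hd : 0 < finrank ℝ V) (hC : IsCompact C)
    (hCc : Convex ℝ C) {s t : ℝ} (hst : s < t) (h0 : 0 < sublevelVolume C f s)
    (h1 : sublevelVolume C f s < volume.real C) :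
    sublevelVolume C f s < sublevelVolume C f t := by
  obtain ⟨M, hM⟩ := exists_sublevelVolume_eq hC f
  set T := max M (t + 1)
  have hT : t < T := lt_of_lt_of_le (by linarith) (le_max_right _ _)
  have hT1 := hM T (le_max_left _ _)
  have hroot : ∀ x : ℝ, 0 < x →
      0 < x ^ ((finrank ℝ V : ℝ)⁻¹) ∧ (x ^ ((finrank ℝ V : ℝ)⁻¹)) ^ finrank ℝ V = x :=
    fun x hx => ⟨Real.rpow_pos_of_pos hx _, Real.rpow_inv_natCast_pow hx.le hd.ne'⟩
  obtain ⟨a0, had⟩ := hroot _ h0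
  obtain ⟨b0, hbd⟩ := hroot _ (h0.trans h1)
  set a := (sublevelVolume C f s) ^ ((finrank ℝ V : ℝ)⁻¹)
  set b := (volume.real C) ^ ((finrank ℝ V : ℝ)⁻¹)
  have hab : a < b := by
    refine lt_of_pow_lt_pow_left₀ (finrank ℝ V) b0.le ?_
    rw [had, hbd]
    exact h1
  set p := (T - t) / (T - s) with hp_def
  set q := (t - s) / (T - s) with hq_def
  have hTs : 0 < T - s := by linarith
  have hp : 0 < p := div_pos (by linarith) hTs
  have hq : 0 < q := div_pos (by linarith) hTs
  have hpq : p + q = 1 := by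
    rw [hp_def, hq_def, ← add_div, div_eq_one_iff_eq hTs.ne']
    ring
  have hpt : p * s + q * T = t := by
    rw [hp_def, hq_def]
    field_simp
    ring
  have key := le_sublevelVolume hV hC hC hC hp hq
    (fun x hx y hy => hCc hx hy hp.le hq.le hpq) a0 b0 had.symm (hT1.trans hbd.symm)
  rw [hpt] at key
  refine lt_of_lt_of_le ?_ key
  rw [← had]
  refine pow_lt_pow_left₀ ?_ a0.le hd.ne'
  calc a = p * a + q * a := by rw [← add_mul, hpq, one_mul]
    _ < p * a + q * b := by gcongr

/-- Put `m = p r + q r'`. Cutting `C` at the right-hand height leaves at least `m ^ d` below, `d`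
being the dimension (lower parts), and at the left-hand height at most `m ^ d` (upper parts). Strict
growth of the volume below a height orders the two heights. -/
theorem quantile_combination_le (hV : PrekopaLeindler V) (hd : 0 < finrank ℝ V)
    (hf : f ≠ 0) (hA : IsCompact A)
    (hB : IsCompact B) (hC : IsCompact C) (hCc : Convex ℝ C)
    (hp : 0 < p) (hq : 0 < q) (hpq : p + q = 1)
    (h : ∀ x ∈ A, ∀ y ∈ B, p • x + q • y ∈ C)
    (hA1 : volume.real A = 1) (hB1 : volume.real B = 1) (hC1 : volume.real C = 1)
    {Z Z' : ℝ → ℝ} (hZ : ∀ r ∈ Ioo (0 : ℝ) 1, sublevelVolume A f (Z r) = r ^ finrank ℝ V)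
    (hZ' : ∀ r ∈ Ioo (0 : ℝ) 1, sublevelVolume B f (Z' r) = r ^ finrank ℝ V)
    {r r' : ℝ} (hr : r ∈ Ioo (0 : ℝ) 1) (hr' : r' ∈ Ioo (0 : ℝ) 1) :
    p * Z (p * r + q * r') + q * Z' (p * r + q * r') ≤ p * Z r + q * Z' r' := by
  have hmem : p * r + q * r' ∈ Ioo (0 : ℝ) 1 := convex_Ioo 0 1 hr hr' hp.le hq.le hpq
  have hlt : (p * r + q * r') ^ finrank ℝ V < 1 := pow_lt_one₀ hmem.1.le hmem.2 hd.ne'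
  have hpos : 0 < (p * r + q * r') ^ finrank ℝ V := pow_pos hmem.1 _
  have h1 := le_sublevelVolume hV hA hB hC hp hq h hr.1 hr'.1 (hZ r hr) (hZ' r' hr')
  have h2 := sublevelVolume_le_of_volume_le hV hd hf hA hB hC hp hq hpq h hA1 hB1 hC1.le hlt
    (hZ _ hmem) (hZ' _ hmem)
  by_contra! hcon
  have hmono := sublevelVolume_mono hC f hcon.le
  have := sublevelVolume_lt hV hd hC hCc hcon (hpos.trans_le h1)
    (by rw [hC1]; exact (hmono.trans h2).trans_lt hlt)
  linarith

end Cuts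

/-- Two convex functions whose weighted sum is dominated by their separate variation differ by a
constant. -/
theorem ConvexOn.sub_le_sub_of_combination_le {f g : ℝ → ℝ} {p q : ℝ} (hp : 0 < p) (hq : 0 < q)
    (hpq : p + q = 1) (hf : ConvexOn ℝ (Ioo 0 1) f) (hg : ConvexOn ℝ (Ioo 0 1) g)
    (h : ∀ r ∈ Ioo (0 : ℝ) 1, ∀ r' ∈ Ioo (0 : ℝ) 1,
      p * f (p * r + q * r') + q * g (p * r + q * r') ≤ p * f r + q * g r')
    {x y : ℝ} (hx : 0 < x) (hxy : x ≤ y) (hy : y < 1) : g y - g x ≤ f y - f x := by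
  -- Apply `h` to `r + q t` and `r - p t`, whose combination is exactly `r`. Expanding both values
  -- by convexity leaves the claim multiplied by `p q`.
  have step : ∀ r t : ℝ, 0 < t → 0 < r - t → r + t < 1 → g r - g (r - t) ≤ f (r + t) - f r := by
    intro r t ht h0 h1
    have m0 : r ∈ Ioo (0 : ℝ) 1 := ⟨by linarith, by linarith⟩
    have m1 : r + t ∈ Ioo (0 : ℝ) 1 := ⟨by linarith, by linarith⟩
    have m2 : r - t ∈ Ioo (0 : ℝ) 1 := ⟨by linarith, by linarith⟩
    have c1 := hf.2 m0 m1 hp.le hq.le hpq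
    have c2 := hg.2 m0 m2 hq.le hp.le (by linarith)
    have n1 := convex_Ioo (0 : ℝ) 1 m0 m1 hp.le hq.le hpq
    have n2 := convex_Ioo (0 : ℝ) 1 m0 m2 hq.le hp.le (by linarith)
    simp only [smul_eq_mul] at c1 c2 n1 n2
    have := h _ n1 _ n2
    have e : p * (p * r + q * (r + t)) + q * (q * r + p * (r - t)) = r := by
      have : q = 1 - p := by linarith
      subst this
      ring
    rw [e] at this
    have hq' : q = 1 - p := by linarith
    subst hq'
    have d1 := mul_le_mul_of_nonneg_left c1 hp.le
    have d2 := mul_le_mul_of_nonneg_left c2 hq.le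
    have hpq0 : 0 < p * (1 - p) := mul_pos hp hq
    refine le_of_mul_le_mul_left ?_ hpq0
    linarith
  -- The steps telescope, with the increments of `f` shifted by one mesh width `t`; continuity of
  -- `f` removes the shift as `t → 0`.
  have chain : ∀ (N : ℕ) (t : ℝ), 0 < t → x + (N + 1) * t < 1 →
      g (x + N * t) - g x ≤ f (x + (N + 1) * t) - f (x + t) := by
    intro N t ht
    induction N with
    | zero => simp
    | succ N ih =>
      intro hN
      push_cast at hN ⊢
      have i1 := ih (by nlinarith)
      have hNt : 0 ≤ (N : ℝ) * t := by positivity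
      have i2 := step (x + (N + 1) * t) t ht (by linarith) (by linarith)
      have e1 : x + (N + 1) * t - t = x + N * t := by ring
      have e2 : x + (N + 1) * t + t = x + (N + 1 + 1) * t := by ring
      rw [e1, e2] at i2
      linarith
  have hcont : ContinuousOn f (Ioo 0 1) := hf.continuousOn isOpen_Ioo
  have hlim : Filter.Tendsto (fun N : ℕ => (y - x) / ((N : ℝ) + 1)) Filter.atTop (nhds 0) := by
    simpa [div_eq_mul_inv] using
      (tendsto_one_div_add_atTop_nhds_zero_nat (𝕜 := ℝ)).const_mul (y - x)
  have hat : ∀ z ∈ Ioo (0 : ℝ) 1, Filter.Tendsto (fun N : ℕ => f (z + (y - x) / ((N : ℝ) + 1)))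
      Filter.atTop (nhds (f z)) := by
    intro z hz
    have h1 : ContinuousAt f z := hcont.continuousAt (isOpen_Ioo.mem_nhds hz)
    refine h1.tendsto.comp ?_
    simpa using hlim.const_add z
  rcases eq_or_lt_of_le hxy with rfl | hlt
  · simp
  refine ge_of_tendsto ((hat y ⟨by linarith, hy⟩).sub (hat x ⟨hx, by linarith⟩)) ?_
  have hsmall : ∀ᶠ N : ℕ in Filter.atTop, (y - x) / ((N : ℝ) + 1) < 1 - y :=
    hlim.eventually_lt_const (by linarith)
  filter_upwards [hsmall] with N hN
  set t := (y - x) / ((N : ℝ) + 1) with ht_def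
  have ht : 0 < t := div_pos (by linarith) (by positivity)
  have hNt : ((N + 1 : ℕ) : ℝ) * t = y - x := by
    rw [ht_def]
    push_cast
    field_simp
  have := chain (N + 1) t ht (by linarith)
  rw [add_mul, hNt] at this
  convert! this using 3
  · ring_nf
  · ring_nf

/-- The hypothesis is symmetric under exchanging `(f, p)` and `(g, q)`, so the increments are
bounded both ways. -/
theorem ConvexOn.eq_add_const_of_combination_le {f g : ℝ → ℝ} {p q : ℝ} (hp : 0 < p) (hq : 0 < q)
    (hpq : p + q = 1) (hf : ConvexOn ℝ (Ioo 0 1) f) (hg : ConvexOn ℝ (Ioo 0 1) g)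
    (h : ∀ r ∈ Ioo (0 : ℝ) 1, ∀ r' ∈ Ioo (0 : ℝ) 1,
      p * f (p * r + q * r') + q * g (p * r + q * r') ≤ p * f r + q * g r') :
    ∃ c, ∀ r ∈ Ioo (0 : ℝ) 1, f r = g r + c := by
  have h1 : ∀ {x y : ℝ}, 0 < x → x ≤ y → y < 1 → f y - f x = g y - g x := by
    intro x y hx hxy hy
    refine le_antisymm ?_ (hf.sub_le_sub_of_combination_le hp hq hpq hg h hx hxy hy)
    refine hg.sub_le_sub_of_combination_le hq hp (by linarith) hf (fun r hr r' hr' => ?_) hx hxy hy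
    have := h r' hr' r hr
    rw [add_comm (p * r')] at this
    linarith
  refine ⟨f (1 / 2) - g (1 / 2), fun r hr => ?_⟩
  rcases le_total r (1 / 2) with hle | hle
  · have := h1 hr.1 hle (by norm_num)
    linarith
  · have := h1 (by norm_num) hle hr.2
    linarith

end BrunnMinkowski

/-! ### The equality case of Brunn–Minkowski. -/

section BrunnMinkowskiEquality

set_option linter.unusedSectionVars false

variable {V : Type*} [NormedAddCommGroup V] [NormedSpace ℝ V] [FiniteDimensional ℝ V]
  [MeasureSpace V] [BorelSpace V] [(volume : Measure V).IsAddHaarMeasure]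
  {A B C : Set V} {p q : ℝ}

open Module

/-- The heights cutting off volume `r ^ d`, `d` the dimension, are convex functions of `r`
(`quantile_combination_le` with all three bodies equal). The mixed inequality makes those of `A` and
`B` differ by a constant, which shifts one distribution function onto the other. -/
theorem exists_sublevelVolume_add_eq (hV : PrekopaLeindler V) (hd : 0 < finrank ℝ V)
    {f : V →L[ℝ] ℝ} (hf : f ≠ 0) (hA : IsCompact A) (hAc : Convex ℝ A) (hB : IsCompact B)
    (hBc : Convex ℝ B) (hC : IsCompact C) (hCc : Convex ℝ C) (hp : 0 < p) (hq : 0 < q)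
    (hpq : p + q = 1) (h : ∀ x ∈ A, ∀ y ∈ B, p • x + q • y ∈ C)
    (hA1 : volume.real A = 1) (hB1 : volume.real B = 1) (hC1 : volume.real C = 1) :
    ∃ c, ∀ s, sublevelVolume A f (s + c) = sublevelVolume B f s := by
  have hmem : ∀ r ∈ Ioo (0 : ℝ) 1, r ^ finrank ℝ V ∈ Ioo (0 : ℝ) 1 := fun r hr =>
    ⟨pow_pos hr.1 _, pow_lt_one₀ hr.1.le hr.2 hd.ne'⟩
  have hquant : ∀ A : Set V, IsCompact A → volume.real A = 1 →
      ∃ Z : ℝ → ℝ, ∀ r ∈ Ioo (0 : ℝ) 1, sublevelVolume A f (Z r) = r ^ finrank ℝ V := by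
    intro A hA hA1
    have : ∀ r : ℝ, ∃ s, r ∈ Ioo (0 : ℝ) 1 → sublevelVolume A f s = r ^ finrank ℝ V := by
      intro r
      by_cases hr : r ∈ Ioo (0 : ℝ) 1
      · obtain ⟨s, hs⟩ := exists_sublevelVolume_eq_of_mem_Ioo hA hf (hA1.symm ▸ hmem r hr)
        exact ⟨s, fun _ => hs⟩
      · exact ⟨0, fun h => absurd h hr⟩
    choose Z hZ using this
    exact ⟨Z, hZ⟩
  have hconv : ∀ A : Set V, IsCompact A → Convex ℝ A → volume.real A = 1 →
      ∀ Z : ℝ → ℝ, (∀ r ∈ Ioo (0 : ℝ) 1, sublevelVolume A f (Z r) = r ^ finrank ℝ V) →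
      ConvexOn ℝ (Ioo 0 1) Z := by
    intro A hA hAc hA1 Z hZ
    refine ⟨convex_Ioo 0 1, fun r hr r' hr' p q hp hq hpq => ?_⟩
    rcases eq_or_lt_of_le hp with rfl | hp
    · have : q = 1 := by linarith
      simp [this]
    rcases eq_or_lt_of_le hq with rfl | hq
    · have : p = 1 := by linarith
      simp [this]
    have := quantile_combination_le hV hd hf hA hA hA hAc hp hq hpq
      (fun x hx y hy => hAc hx hy hp.le hq.le hpq) hA1 hA1 hA1 hZ hZ hr hr'
    rwa [← add_mul, hpq, one_mul] at this
  obtain ⟨Z, hZ⟩ := hquant A hA hA1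
  obtain ⟨Z', hZ'⟩ := hquant B hB hB1
  obtain ⟨c, hc⟩ := (hconv A hA hAc hA1 Z hZ).eq_add_const_of_combination_le hp hq hpq
    (hconv B hB hBc hB1 Z' hZ') fun r hr r' hr' =>
      quantile_combination_le hV hd hf hA hB hC hCc hp hq hpq h hA1 hB1 hC1 hZ hZ' hr hr'
  have main : ∀ (A B : Set V) (Z Z' : ℝ → ℝ) (c : ℝ), IsCompact A → IsCompact B →
      volume.real A = 1 → volume.real B = 1 →
      (∀ r ∈ Ioo (0 : ℝ) 1, sublevelVolume A f (Z r) = r ^ finrank ℝ V) →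
      (∀ r ∈ Ioo (0 : ℝ) 1, sublevelVolume B f (Z' r) = r ^ finrank ℝ V) →
      (∀ r ∈ Ioo (0 : ℝ) 1, Z r = Z' r + c) →
      ∀ s, sublevelVolume B f s ≤ sublevelVolume A f (s + c) := by
    intro A B Z Z' c hA hB hA1 hB1 hZ hZ' hc s
    by_contra! hlt
    obtain ⟨τ, h1, h2⟩ := exists_between hlt
    have hτ0 : 0 < τ := lt_of_le_of_lt measureReal_nonneg h1
    have hτ1 : τ < 1 := h2.trans_le (hB1 ▸ sublevelVolume_le hB f s)
    set r : ℝ := τ ^ ((finrank ℝ V : ℝ)⁻¹)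
    have hrd : r ^ finrank ℝ V = τ := Real.rpow_inv_natCast_pow hτ0.le hd.ne'
    have hr : r ∈ Ioo (0 : ℝ) 1 := ⟨Real.rpow_pos_of_pos hτ0 _,
      Real.rpow_lt_one hτ0.le hτ1 (by positivity)⟩
    have g1 : Z' r < s := by
      by_contra! hle
      have := sublevelVolume_mono hB f hle
      rw [hZ' r hr, hrd] at this
      linarith
    have g2 : s + c < Z r := by
      by_contra! hle
      have := sublevelVolume_mono hA f hle
      rw [hZ r hr, hrd] at this
      linarith
    rw [hc r hr] at g2
    linarith
  refine ⟨c, fun s => le_antisymm ?_ (main A B Z Z' c hA hB hA1 hB1 hZ hZ' hc s)⟩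
  have := main B A Z' Z (-c) hB hA hB1 hA1 hZ' hZ (fun r hr => by rw [hc r hr]; ring) (s + c)
  simpa using this

/-- The equality case of the Brunn–Minkowski inequality for bodies of volume one. -/
theorem exists_eq_image_add_of_volume_eq_one (hV : PrekopaLeindler V) (hd : 0 < finrank ℝ V)
    (hA : IsCompact A) (hAc : Convex ℝ A) (hB : IsCompact B)
    (hBc : Convex ℝ B) (hC : IsCompact C) (hCc : Convex ℝ C) (hp : 0 < p) (hq : 0 < q)
    (hpq : p + q = 1) (h : ∀ x ∈ A, ∀ y ∈ B, p • x + q • y ∈ C)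
    (hA1 : volume.real A = 1) (hB1 : volume.real B = 1) (hC1 : volume.real C = 1) :
    ∃ g, A = (fun x => g + x) '' B := by
  have hfin : ∀ A : Set V, IsCompact A → IsFiniteMeasure (volume.restrict A) := fun A hA => ⟨by
    rw [Measure.restrict_apply_univ]
    exact hA.measure_lt_top⟩
  have := hfin A hA
  have := hfin B hB
  have hint : ∀ A : Set V, IsCompact A → Integrable (fun x : V => x) (volume.restrict A) :=
    fun A hA => continuous_id.continuousOn.integrableOn_compact hA
  have hIic : ∀ (A : Set V), IsCompact A → ∀ (f : V →L[ℝ] ℝ) (s : ℝ),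
      volume.restrict A (f ⁻¹' Iic s) = ENNReal.ofReal (sublevelVolume A f s) := by
    intro A hA f s
    rw [Measure.restrict_apply (f.continuous.measurable measurableSet_Iic), sublevelVolume,
      measureReal_def, ENNReal.ofReal_toReal
        (measure_ne_top_of_subset inter_subset_left hA.measure_ne_top), inter_comm]
  -- The only possible translation vector: the difference of the centroids.
  set g : V := (∫ x in A, x) - ∫ x in B, x
  have hmap : ∀ f : V →L[ℝ] ℝ,
      (volume.restrict A).map f = (volume.restrict B).map fun x => f (g + x) := by
    intro f
    rcases eq_or_ne f 0 with rfl | hf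
    · have e : volume A = volume B := by
        rw [← ENNReal.toReal_eq_toReal_iff' hA.measure_ne_top hB.measure_ne_top]
        exact hA1.trans hB1.symm
      change Measure.map (fun _ => (0 : ℝ)) _ = Measure.map (fun _ => (0 : ℝ)) _
      simp [Measure.map_const, e]
    obtain ⟨c, hc⟩ := exists_sublevelVolume_add_eq hV hd hf hA hAc hB hBc hC hCc hp hq hpq h
      hA1 hB1 hC1
    have h1 : (volume.restrict A).map f = (volume.restrict B).map fun x => f x + c := by
      have hm : Measurable fun x => f x + c := f.continuous.measurable.add_const c
      have : IsFiniteMeasure ((volume.restrict A).map f) := Measure.isFiniteMeasure_map _ _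
      refine Measure.ext_of_Iic _ _ fun s => ?_
      rw [Measure.map_apply f.continuous.measurable measurableSet_Iic,
        Measure.map_apply hm measurableSet_Iic, hIic A hA]
      have e : (fun x => f x + c) ⁻¹' Iic s = f ⁻¹' Iic (s - c) := by
        ext x
        simp [le_sub_iff_add_le]
      rw [e, hIic B hB, ← hc, sub_add_cancel]
    -- Comparing means identifies the shift `c`, which a priori depends on `f`, as `f g`.
    have h2 : ∫ x in A, f x = (∫ x in B, f x) + c := by
      have e1 : ∫ x in A, f x = ∫ y, y ∂((volume.restrict A).map f) :=
        (integral_map f.continuous.aemeasurable aestronglyMeasurable_id).symm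
      have e2 : ∫ x in B, (f x + c) = ∫ y, y ∂((volume.restrict B).map fun x => f x + c) :=
        (integral_map (f.continuous.measurable.add_const c).aemeasurable
          aestronglyMeasurable_id).symm
      rw [e1, h1, ← e2, integral_add (f.integrable_comp (hint B hB)) (integrable_const c)]
      simp [hB1]
    rw [f.integral_comp_comm (hint A hA), f.integral_comp_comm (hint B hB)] at h2
    have hcg : c = f g := by
      simp only [g, map_sub]
      linarith
    rw [h1, hcg]
    simp only [map_add, add_comm]
  have hgm : Measurable fun x : V => g + x := measurable_const_add g
  have hμ : volume.restrict A = (volume.restrict B).map fun x => g + x := by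
    have : IsFiniteMeasure ((volume.restrict B).map fun x => g + x) :=
      Measure.isFiniteMeasure_map _ _
    -- The one-dimensional images under all functionals determine the measure.
    refine Measure.ext_of_charFunDual (funext fun f => ?_)
    rw [charFunDual_eq_charFun_map_one, charFunDual_eq_charFun_map_one,
      Measure.map_map f.continuous.measurable hgm, hmap f]
    rfl
  have hvol0 : ∀ A : Set V, volume.real A = 1 → volume A ≠ 0 := by
    intro A hA h0
    rw [measureReal_def, h0] at hA
    simp at hA
  have hclosed : IsClosed ((fun x => g + x) '' B) :=
    (hB.image (continuous_const.add continuous_id)).isClosed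
  refine ⟨g, Subset.antisymm ?_ ?_⟩
  · refine hAc.subset_of_volume_sdiff_eq_zero
      (hAc.interior_nonempty_of_volume_pos (hvol0 A hA1)) hclosed ?_
    rw [Set.sdiff_eq, inter_comm, ← Measure.restrict_apply hclosed.measurableSet.compl, hμ,
      Measure.map_apply hgm hclosed.measurableSet.compl,
      Measure.restrict_apply (hgm hclosed.measurableSet.compl)]
    convert measure_empty (μ := (volume : Measure V))
    ext x
    simp
  · rw [image_subset_iff]
    refine hBc.subset_of_volume_sdiff_eq_zero
      (hBc.interior_nonempty_of_volume_pos (hvol0 B hB1))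
      (hA.isClosed.preimage (continuous_const.add continuous_id)) ?_
    have h0 : volume.restrict A Aᶜ = 0 := by
      rw [Measure.restrict_apply hA.measurableSet.compl]
      simp
    rw [hμ, Measure.map_apply hgm hA.measurableSet.compl,
      Measure.restrict_apply (hgm hA.measurableSet.compl), inter_comm] at h0
    exact h0

/-- The equality case of the Brunn–Minkowski inequality for convex bodies. -/
theorem exists_eq_image_add_smul_of_volume_eq (hV : PrekopaLeindler V) (hd : 0 < finrank ℝ V)
    (hA : IsCompact A) (hAc : Convex ℝ A) (hB : IsCompact B)
    (hBc : Convex ℝ B) (hC : IsCompact C) (hCc : Convex ℝ C) (hp : 0 < p) (hq : 0 < q)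
    (h : ∀ x ∈ A, ∀ y ∈ B, p • x + q • y ∈ C) {a b : ℝ} (ha : 0 < a) (hb : 0 < b)
    (hAa : volume.real A = a ^ finrank ℝ V) (hBb : volume.real B = b ^ finrank ℝ V)
    (hCe : volume.real C = (p * a + q * b) ^ finrank ℝ V) :
    ∃ g, ∃ c : ℝ, 0 < c ∧ A = (fun x => g + c • x) '' B := by
  set e := p * a + q * b
  have he : 0 < e := by positivity
  have hone : ∀ (c : ℝ) (S : Set V), 0 < c → volume.real S = c ^ finrank ℝ V →
      volume.real (c⁻¹ • S) = 1 := by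
    intro c S hc hS
    rw [measureReal_def, Measure.addHaar_smul, ENNReal.toReal_mul, ← measureReal_def, hS,
      ENNReal.toReal_ofReal (abs_nonneg _), abs_of_pos (by positivity), ← mul_pow,
      inv_mul_cancel₀ hc.ne', one_pow]
  have hcomb : ∀ x ∈ a⁻¹ • A, ∀ y ∈ b⁻¹ • B, (p * a / e) • x + (q * b / e) • y ∈ e⁻¹ • C := by
    rintro _ ⟨x, hx, rfl⟩ _ ⟨y, hy, rfl⟩
    refine ⟨p • x + q • y, h x hx y hy, ?_⟩
    simp only [smul_add, smul_smul]
    congr 2 <;> field_simp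
  obtain ⟨g, hg⟩ := exists_eq_image_add_of_volume_eq_one hV hd (hA.smul a⁻¹) (hAc.smul a⁻¹)
    (hB.smul b⁻¹) (hBc.smul b⁻¹) (hC.smul e⁻¹) (hCc.smul e⁻¹) (p := p * a / e) (q := q * b / e)
    (by positivity) (by positivity) (by rw [← add_div, div_self he.ne']) hcomb
    (hone a A ha hAa) (hone b B hb hBb) (hone e C he hCe)
  refine ⟨a • g, a * b⁻¹, by positivity, ?_⟩
  have : A = a • (a⁻¹ • A) := by rw [smul_inv_smul₀ ha.ne']
  rw [this, hg, ← image_smul, ← image_smul, image_image, image_image]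
  simp only [smul_add, smul_smul]

end BrunnMinkowskiEquality

/-! ### The integral of the interpolated slice volume. -/

/-- The base runs affinely from `b` to `a`, so for `a ≠ b` the mean of its power is `(a ^ n - b ^ n)
/ (n (a - b))`, a geometric sum. -/
theorem integral_pow_affine {h₁ h₂ a b : ℝ} (hh : 0 < h₁ + h₂) {n : ℕ} (hn : 1 ≤ n) :
    ∫ s in (-h₂)..h₁, ((h₂ + s) / (h₁ + h₂) * a + (h₁ - s) / (h₁ + h₂) * b) ^ (n - 1) =
      (h₁ + h₂) / n * ∑ i ∈ Finset.range n, a ^ (n - 1 - i) * b ^ i := by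
  obtain ⟨m, rfl⟩ : ∃ m, n = m + 1 := ⟨n - 1, by omega⟩
  simp only [Nat.add_sub_cancel]
  have hm : ((m + 1 : ℕ) : ℝ) ≠ 0 := by positivity
  rcases eq_or_ne a b with rfl | hab
  · have e1 : ∀ s : ℝ, (h₂ + s) / (h₁ + h₂) * a + (h₁ - s) / (h₁ + h₂) * a = a := by
      intro s
      field_simp
      ring
    have e2 : ∑ i ∈ Finset.range (m + 1), a ^ (m - i) * a ^ i = (m + 1 : ℕ) * a ^ m := by
      rw [Finset.sum_congr rfl fun i hi => by
        rw [← pow_add, Nat.sub_add_cancel (by simpa [Nat.lt_succ_iff] using hi)]]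
      simp
    simp only [e1, e2, intervalIntegral.integral_const, smul_eq_mul]
    field_simp
    ring
  · have hab' : a - b ≠ 0 := sub_ne_zero.2 hab
    have e1 : ∀ s : ℝ, (h₂ + s) / (h₁ + h₂) * a + (h₁ - s) / (h₁ + h₂) * b =
        (a - b) / (h₁ + h₂) * s + (h₂ * a + h₁ * b) / (h₁ + h₂) := by
      intro s
      field_simp
      ring
    have e2 : (∑ i ∈ Finset.range (m + 1), a ^ (m - i) * b ^ i) * (a - b) =
        a ^ (m + 1) - b ^ (m + 1) := by
      have := Commute.geom_sum₂_mul (Commute.all b a) (m + 1)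
      simp only [Nat.add_sub_cancel] at this
      rw [show (∑ i ∈ Finset.range (m + 1), a ^ (m - i) * b ^ i) =
        ∑ i ∈ Finset.range (m + 1), b ^ i * a ^ (m - i) from
          Finset.sum_congr rfl fun _ _ => mul_comm _ _]
      linarith
    have e3 : (a - b) / (h₁ + h₂) * (-h₂) + (h₂ * a + h₁ * b) / (h₁ + h₂) = b := by
      field_simp
      ring
    have e4 : (a - b) / (h₁ + h₂) * h₁ + (h₂ * a + h₁ * b) / (h₁ + h₂) = a := by
      field_simp
      ring
    simp only [e1]
    rw [intervalIntegral.integral_comp_mul_add (fun x => x ^ m) (div_ne_zero hab' hh.ne'), e3, e4,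
      integral_pow, ← e2, smul_eq_mul]
    push_cast
    field_simp

/-- With `ϱ² = a / b`, both halves of the `i`-th term become multiples of `a ^ (n - 1 - i) * b ^ i`,
with factors `h₁ / n` and `h₂ / n`. -/
theorem phiObjective_sqrt_div {h₁ h₂ a b : ℝ} (ha : 0 < a) (hb : 0 < b) (n : ℕ) :
    phiObjective (h₁ * a ^ (n - 1) / n) (h₂ * b ^ (n - 1) / n) n (Real.sqrt (a / b)) =
      (h₁ + h₂) / n * ∑ i ∈ Finset.range n, a ^ (n - 1 - i) * b ^ i := by
  have hr : 0 < Real.sqrt (a / b) := Real.sqrt_pos.2 (div_pos ha hb)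
  rw [phiObjective_eq_sum _ _ _ hr, Finset.mul_sum]
  refine Finset.sum_congr rfl fun i hi => ?_
  obtain ⟨j, hj⟩ : ∃ j, n = i + j + 1 := ⟨n - 1 - i, by have := Finset.mem_range.1 hi; omega⟩
  have e1 : Real.sqrt (a / b) ^ (-(2 * (i : ℤ))) = ((a / b) ^ i)⁻¹ := by
    rw [zpow_neg, zpow_mul]
    norm_cast
    rw [Real.sq_sqrt (div_pos ha hb).le]
  have e2 : Real.sqrt (a / b) ^ (2 * ((n : ℤ) - 1 - (i : ℤ))) = (a / b) ^ j := by
    rw [show (n : ℤ) - 1 - i = (j : ℤ) by omega, zpow_mul]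
    norm_cast
    rw [Real.sq_sqrt (div_pos ha hb).le]
  rw [e1, e2, show n - 1 = i + j by omega, Nat.add_sub_cancel_left]
  have : (n : ℝ) ≠ 0 := by rw [hj]; positivity
  simp only [div_pow, pow_add]
  field_simp

theorem lintegral_pow_affine {h₁ h₂ a b : ℝ} (h1 : 0 < h₁) (h2 : 0 < h₂) (ha : 0 < a) (hb : 0 < b)
    {n : ℕ} (hn : 1 ≤ n) :
    ∫⁻ s in Ioo (-h₂) h₁, ENNReal.ofReal
        (((h₂ + s) / (h₁ + h₂) * a + (h₁ - s) / (h₁ + h₂) * b) ^ (n - 1)) =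
      ENNReal.ofReal (phiObjective (h₁ * a ^ (n - 1) / n) (h₂ * b ^ (n - 1) / n) n
        (Real.sqrt (a / b))) := by
  have hh : 0 < h₁ + h₂ := by positivity
  rw [phiObjective_sqrt_div ha hb, ← integral_pow_affine hh hn,
    intervalIntegral.integral_of_le (by linarith), restrict_Ioo_eq_restrict_Ioc]
  refine (ofReal_integral_eq_lintegral_ofReal ?_ ?_).symm
  · refine (Continuous.integrableOn_Icc ?_).mono_set Ioc_subset_Icc_self
    fun_prop
  · filter_upwards [ae_restrict_mem measurableSet_Ioc] with s hs
    have g1 : 0 ≤ h₂ + s := by linarith [hs.1]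
    have g2 : 0 ≤ h₁ - s := by linarith [hs.2]
    exact pow_nonneg (by positivity) _

/-! ### Slices orthogonal to `u` and the volume bound. -/

section Slice

variable {V E : Type*} [NormedAddCommGroup V] [InnerProductSpace ℝ V] [FiniteDimensional ℝ V]
  [MeasurableSpace V] [BorelSpace V] [NormedAddCommGroup E] [InnerProductSpace ℝ E]
  [FiniteDimensional ℝ E] [MeasurableSpace E] [BorelSpace E]

open Module

/-- The slice of `S` at height `s` in the direction `u`, in the coordinates given by `L`. -/
def slice (u : E) (L : V →ₗᵢ[ℝ] E) (S : Set E) (s : ℝ) : Set V := {w | s • u + L w ∈ S}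

set_option linter.unusedSectionVars false

variable {u : E} {L : V →ₗᵢ[ℝ] E} {S : Set E} {s : ℝ}

theorem isometry_slice (u : E) (L : V →ₗᵢ[ℝ] E) (s : ℝ) : Isometry fun w => s • u + L w :=
  (IsometryEquiv.addLeft (s • u)).isometry.comp L.isometry

theorem IsCompact.slice (hS : IsCompact S) : IsCompact (slice u L S s) :=
  (isometry_slice u L s).isClosedEmbedding.isCompact_preimage hS

theorem Convex.slice (hS : Convex ℝ S) : Convex ℝ (slice u L S s) := by
  intro x hx y hy p q hp hq hpq
  have := hS hx hy hp hq hpq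
  show s • u + L (p • x + q • y) ∈ S
  convert! this using 1
  obtain rfl : q = 1 - p := by linarith
  simp only [map_add, map_smul]
  module

theorem slice_combination (hS : Convex ℝ S) {s t p q : ℝ} (hp : 0 ≤ p) (hq : 0 ≤ q)
    (hpq : p + q = 1) {x y : V} (hx : x ∈ slice u L S s) (hy : y ∈ slice u L S t) :
    p • x + q • y ∈ slice u L S (p * s + q * t) := by
  have := hS hx hy hp hq hpq
  show (p * s + q * t) • u + L (p • x + q • y) ∈ S
  convert! this using 1
  simp only [map_add, map_smul]
  module

theorem image_slice (hL : ∀ x, x ∈ range L ↔ ⟪x, u⟫_ℝ = 0) (hu : ‖u‖ = 1) (S : Set E) (s : ℝ) :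
    (fun w => s • u + L w) '' slice u L S s = {x ∈ S | ⟪x, u⟫_ℝ = s} := by
  ext x
  constructor
  · rintro ⟨w, hw, rfl⟩
    refine ⟨hw, ?_⟩
    rw [inner_add_left, real_inner_smul_left, real_inner_self_eq_norm_sq, hu,
      (hL _).1 (mem_range_self w)]
    ring
  · rintro ⟨hx, hxs⟩
    obtain ⟨w, hw⟩ := (hL (x - s • u)).2 (by
      rw [inner_sub_left, real_inner_smul_left, real_inner_self_eq_norm_sq, hu, hxs]
      ring)
    have : s • u + L w = x := by rw [hw]; abel
    exact ⟨w, by show s • u + L w ∈ S; rwa [this], this⟩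

theorem volume_eq_lintegral_slice (hL : ∀ x, x ∈ range L ↔ ⟪x, u⟫_ℝ = 0) (hu : ‖u‖ = 1)
    (hVE : finrank ℝ E - 1 = finrank ℝ V) (hS : MeasurableSet S) :
    volume S = ∫⁻ s, volume (slice u L S s) := by
  have hu0 : u ≠ 0 := by
    rintro rfl
    simp at hu
  rw [← InnerProductSpace.euclideanHausdorffMeasure_eq_volume (V := E),
    EuclideanGeometry.euclideanHausdorffMeasure_eq_lintegral (0 : E) hu0 hS]
  have : ‖u‖ₑ = 1 := by rw [← ofReal_norm, hu, ENNReal.ofReal_one]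
  rw [this, one_mul]
  congr 1
  ext s
  rw [← InnerProductSpace.euclideanHausdorffMeasure_eq_volume (V := V),
    ← (isometry_slice u L s).euclideanHausdorffMeasure_image, image_slice hL hu, hVE]
  congr 1
  ext x
  simp only [mem_inter_iff, SetLike.mem_coe, AffineSubspace.mem_mk', vsub_eq_sub, vadd_eq_add,
    add_zero, Submodule.mem_orthogonal_singleton_iff_inner_left, inner_sub_left,
    real_inner_smul_left, real_inner_self_eq_norm_sq, hu]
  refine and_congr_right fun _ => ?_
  constructor <;> intro h <;> linarith

theorem measurable_volume_slice (hS : IsClosed S) :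
    Measurable fun s => volume (slice u L S s) := by
  have hc : Continuous fun x : ℝ × V => x.1 • u + L x.2 := by fun_prop
  exact measurable_measure_prodMk_left (hS.preimage hc).measurableSet

theorem le_volume_slice (hV : PrekopaLeindler V) (hS : IsCompact S) (hSc : Convex ℝ S)
    {h₁ h₂ a b : ℝ} (h1 : 0 < h₁) (h2 : 0 < h₂) (ha : 0 < a) (hb : 0 < b)
    (hSa : volume.real (slice u L S h₁) = a ^ finrank ℝ V)
    (hSb : volume.real (slice u L S (-h₂)) = b ^ finrank ℝ V) (hs : s ∈ Ioo (-h₂) h₁) :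
    ENNReal.ofReal (((h₂ + s) / (h₁ + h₂) * a + (h₁ - s) / (h₁ + h₂) * b) ^ finrank ℝ V) ≤
      volume (slice u L S s) := by
  have hh : 0 < h₁ + h₂ := by positivity
  have hp : 0 < (h₂ + s) / (h₁ + h₂) := div_pos (by linarith [hs.1]) hh
  have hq : 0 < (h₁ - s) / (h₁ + h₂) := div_pos (by linarith [hs.2]) hh
  refine ENNReal.ofReal_le_of_le_toReal ?_
  refine hV.brunnMinkowski hS.slice.measurableSet hS.slice.measurableSet hS.slice.measurableSet
    hS.slice.measure_ne_top ha hb hp hq hSa hSb fun x hx y hy => ?_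
  have := slice_combination hSc hp.le hq.le (by field_simp; ring) hx hy
  convert! this using 2
  field_simp
  ring

/-- Fubini and Brunn–Minkowski on each slice. Only the two extreme slices of `S` enter, so the bound
serves both `K` and the hull of its faces. -/
theorem phiObjective_le_volume (hV : PrekopaLeindler V)
    (hL : ∀ x, x ∈ range L ↔ ⟪x, u⟫_ℝ = 0) (hu : ‖u‖ = 1) {n : ℕ} (hn : 1 ≤ n)
    (hE : finrank ℝ E = n) (hVd : finrank ℝ V = n - 1) (hS : IsCompact S) (hSc : Convex ℝ S)
    {h₁ h₂ a b : ℝ} (h1 : 0 < h₁) (h2 : 0 < h₂) (ha : 0 < a) (hb : 0 < b)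
    (hSa : volume.real (slice u L S h₁) = a ^ (n - 1))
    (hSb : volume.real (slice u L S (-h₂)) = b ^ (n - 1)) :
    ENNReal.ofReal (phiObjective (h₁ * a ^ (n - 1) / n) (h₂ * b ^ (n - 1) / n) n
        (Real.sqrt (a / b))) ≤ volume S := by
  rw [← lintegral_pow_affine h1 h2 ha hb hn,
    volume_eq_lintegral_slice hL hu (by rw [hE, hVd]) hS.measurableSet]
  refine le_trans (setLIntegral_mono' measurableSet_Ioo fun s hs => ?_)
    (setLIntegral_le_lintegral (Ioo (-h₂) h₁) _)
  rw [← hVd] at hSa hSb ⊢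
  exact le_volume_slice hV hS hSc h1 h2 ha hb hSa hSb hs

/-- Equality of the integrals forces equality at almost every height; one height suffices to obtain
homothety. -/
theorem exists_volume_slice_eq (hV : PrekopaLeindler V)
    (hL : ∀ x, x ∈ range L ↔ ⟪x, u⟫_ℝ = 0) (hu : ‖u‖ = 1) {n : ℕ} (hn : 1 ≤ n)
    (hE : finrank ℝ E = n) (hVd : finrank ℝ V = n - 1) (hS : IsCompact S) (hSc : Convex ℝ S)
    {h₁ h₂ a b : ℝ} (h1 : 0 < h₁) (h2 : 0 < h₂) (ha : 0 < a) (hb : 0 < b)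
    (hSa : volume.real (slice u L S h₁) = a ^ (n - 1))
    (hSb : volume.real (slice u L S (-h₂)) = b ^ (n - 1))
    (hle : volume S ≤ ENNReal.ofReal (phiObjective (h₁ * a ^ (n - 1) / n)
      (h₂ * b ^ (n - 1) / n) n (Real.sqrt (a / b)))) :
    ∃ s ∈ Ioo (-h₂) h₁, volume.real (slice u L S s) =
      ((h₂ + s) / (h₁ + h₂) * a + (h₁ - s) / (h₁ + h₂) * b) ^ (n - 1) := by
  rw [← lintegral_pow_affine h1 h2 ha hb hn,
    volume_eq_lintegral_slice hL hu (by rw [hE, hVd]) hS.measurableSet] at hle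
  have hh : 0 < h₁ + h₂ := by positivity
  have hle' := fun s (hs : s ∈ Ioo (-h₂) h₁) => le_volume_slice (s := s) hV hS hSc h1 h2 ha hb
    (by rw [hVd]; exact hSa) (by rw [hVd]; exact hSb) hs
  have hae := ae_eq_of_ae_le_of_lintegral_le
    (μ := volume.restrict (Ioo (-h₂) h₁)) (f := fun s => ENNReal.ofReal
      (((h₂ + s) / (h₁ + h₂) * a + (h₁ - s) / (h₁ + h₂) * b) ^ finrank ℝ V))
    (g := fun s => volume (slice u L S s))
    (by filter_upwards [ae_restrict_mem measurableSet_Ioo] with s hs using hle' s hs)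
    (by rw [hVd, lintegral_pow_affine h1 h2 ha hb hn]; exact ENNReal.ofReal_ne_top)
    (measurable_volume_slice hS.isClosed).aemeasurable
    (by rw [hVd]; exact (setLIntegral_le_lintegral _ _).trans hle)
  have : NeZero (volume.restrict (Ioo (-h₂) h₁)) := ⟨by
    rw [Ne, Measure.restrict_eq_zero, Real.volume_Ioo]
    simpa using hh⟩
  obtain ⟨s, hs, hmem⟩ := (hae.and (ae_restrict_mem measurableSet_Ioo)).exists
  refine ⟨s, hmem, ?_⟩
  have g1 : 0 ≤ h₂ + s := by linarith [hmem.1]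
  have g2 : 0 ≤ h₁ - s := by linarith [hmem.2]
  have hs : ENNReal.ofReal _ = volume (slice u L S s) := hs
  rw [measureReal_def, ← hs, ENNReal.toReal_ofReal (pow_nonneg (by positivity) _), hVd]

end Slice

/-! ### Cone volume of a single direction. -/

namespace ConvexBody

variable {n : ℕ} {K : ConvexBody (EuclideanSpace ℝ (Fin n))} {u : EuclideanSpace ℝ (Fin n)}

theorem inner_le_supportFunction {x : EuclideanSpace ℝ (Fin n)} (hx : x ∈ K) :
    ⟪x, u⟫_ℝ ≤ K.supportFunction u :=
  le_csSup (K.isCompact.image (by fun_prop)).bddAbove (mem_image_of_mem (fun x => ⟪x, u⟫_ℝ) hx)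

theorem isCompact_face (K : ConvexBody (EuclideanSpace ℝ (Fin n)))
    (u : EuclideanSpace ℝ (Fin n)) : IsCompact (K.face u) :=
  K.isCompact.inter_right (isClosed_eq (by fun_prop) continuous_const)

theorem face_subset : K.face u ⊆ K := fun _ hx => hx.1

theorem convex_face (K : ConvexBody (EuclideanSpace ℝ (Fin n)))
    (u : EuclideanSpace ℝ (Fin n)) : Convex ℝ (K.face u) := by
  intro x hx y hy p q hp hq hpq
  refine ⟨K.convex hx.1 hy.1 hp hq hpq, ?_⟩
  rw [inner_add_left, real_inner_smul_left, real_inner_smul_left, hx.2, hy.2, ← add_mul, hpq,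
    one_mul]

theorem add_smul_mem_of_mem_interior {S : Set (EuclideanSpace ℝ (Fin n))}
    {x v : EuclideanSpace ℝ (Fin n)} (hx : x ∈ interior S) :
    ∃ ε : ℝ, 0 < ε ∧ x + ε • v ∈ S := by
  have hc : Filter.Tendsto (fun ε : ℝ => x + ε • v) (nhds 0) (nhds x) := by
    have : Continuous fun ε : ℝ => x + ε • v := by fun_prop
    simpa using this.tendsto 0
  obtain ⟨δ, hδ, h⟩ := Metric.eventually_nhds_iff.1 (hc.eventually (mem_interior_iff_mem_nhds.1 hx))
  exact ⟨δ / 2, by positivity, h (by simp [abs_of_pos hδ]; linarith)⟩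

theorem supportFunction_pos (hK0 : 0 ∈ interior (K : Set (EuclideanSpace ℝ (Fin n))))
    (hu : ‖u‖ = 1) : 0 < K.supportFunction u := by
  obtain ⟨ε, hε, h⟩ := add_smul_mem_of_mem_interior (v := u) hK0
  refine lt_of_lt_of_le hε ?_
  have := inner_le_supportFunction (K := K) (u := u) h
  rwa [zero_add, real_inner_smul_left, real_inner_self_eq_norm_sq, hu, one_pow, mul_one] at this

variable {L : EuclideanSpace ℝ (Fin (n - 1)) →ₗᵢ[ℝ] EuclideanSpace ℝ (Fin n)}

theorem face_eq_image_slice (hL : ∀ x, x ∈ range L ↔ ⟪x, u⟫_ℝ = 0) (hu : ‖u‖ = 1) :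
    K.face u = (fun w => K.supportFunction u • u + L w) ''
      slice u L (K : Set (EuclideanSpace ℝ (Fin n))) (K.supportFunction u) :=
  (image_slice hL hu _ _).symm

/-- From such a point one can move both ways in every direction of the hyperplane, so `v` is
orthogonal to it and `v = ±u`. The origin, lying in `K`, rules out `-u`. -/
theorem IsOuterNormal.eq_of_mem_interior_slice
    (hK0 : 0 ∈ interior (K : Set (EuclideanSpace ℝ (Fin n))))
    (hL : ∀ x, x ∈ range L ↔ ⟪x, u⟫_ℝ = 0) (hu : ‖u‖ = 1)
    {w : EuclideanSpace ℝ (Fin (n - 1))}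
    (hw : w ∈ interior (slice u L (K : Set (EuclideanSpace ℝ (Fin n))) (K.supportFunction u)))
    {v : EuclideanSpace ℝ (Fin n)} (hv1 : ‖v‖ = 1)
    (hv : K.IsOuterNormal (K.supportFunction u • u + L w) v) : v = u := by
  have hle : ∀ z, ⟪L z, v⟫_ℝ ≤ 0 := by
    intro z
    obtain ⟨ε, hε, h⟩ := add_smul_mem_of_mem_interior (v := z) hw
    have := hv _ h
    simp only [map_add, map_smul, inner_add_left, real_inner_smul_left] at this
    nlinarith
  have hzero : ∀ z, ⟪L z, v⟫_ℝ = 0 := fun z =>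
    le_antisymm (hle z) (by simpa using hle (-z))
  obtain ⟨z, hz⟩ := (hL (v - ⟪v, u⟫_ℝ • u)).2 (by
    rw [inner_sub_left, real_inner_smul_left, real_inner_self_eq_norm_sq, hu]
    ring)
  have hz0 : L z = 0 := by
    rw [← inner_self_eq_zero (𝕜 := ℝ)]
    nth_rewrite 2 [hz]
    rw [inner_sub_right, hzero, real_inner_smul_right, (hL _).1 (mem_range_self z)]
    ring
  rw [hz0, eq_comm, sub_eq_zero] at hz
  have hsq : ⟪v, u⟫_ℝ ^ 2 = 1 := by
    have := congrArg norm hz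
    rw [norm_smul, hu, hv1, mul_one, Real.norm_eq_abs] at this
    rw [← sq_abs, ← this, one_pow]
  have h0 := hv 0 (interior_subset hK0)
  have hpos := supportFunction_pos hK0 hu
  rw [inner_zero_left, inner_add_left, hzero, real_inner_smul_left, real_inner_comm] at h0
  have hnn : 0 ≤ ⟪v, u⟫_ℝ := by
    by_contra! hneg
    nlinarith
  have : ⟪v, u⟫_ℝ = 1 := by nlinarith
  rw [hz, this, one_smul]

/-- Points with Gauss image `u` lie in the face and include its relative interior. The relative
boundary of the face is null by convexity, and the integrand is constantly `h / n`. -/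
theorem coneVolumeMeasure_singleton (hK0 : 0 ∈ interior (K : Set (EuclideanSpace ℝ (Fin n))))
    (u : Metric.sphere (0 : EuclideanSpace ℝ (Fin n)) 1)
    (hL : ∀ x, x ∈ range L ↔ ⟪x, (u : EuclideanSpace ℝ (Fin n))⟫_ℝ = 0) :
    K.coneVolumeMeasure {u} = ENNReal.ofReal (K.supportFunction u * volume.real
      (slice (u : EuclideanSpace ℝ (Fin n)) L (K : Set (EuclideanSpace ℝ (Fin n)))
        (K.supportFunction u)) / n) := by
  have hu : ‖(u : EuclideanSpace ℝ (Fin n))‖ = 1 := norm_eq_of_mem_sphere u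
  have hpos := supportFunction_pos hK0 hu
  set h := K.supportFunction u
  set A := slice (u : EuclideanSpace ℝ (Fin n)) L (K : Set (EuclideanSpace ℝ (Fin n))) h
  have hinner : ∀ x ∈ K.gaussMap ⁻¹' {u},
      ⟪(x : EuclideanSpace ℝ (Fin n)), (u : EuclideanSpace ℝ (Fin n))⟫_ℝ = h := by
    intro x hx
    have hx : K.gaussMap x = u := hx
    have hN := K.gaussMap_spec x
    rw [hx] at hN
    have hxK : (x : EuclideanSpace ℝ (Fin n)) ∈ K := K.isCompact.isClosed.frontier_subset x.2.1
    refine le_antisymm (inner_le_supportFunction hxK) ?_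
    refine csSup_le (K.nonempty.image _) ?_
    rintro _ ⟨y, hy, rfl⟩
    exact hN y hy
  have hiso := isometry_slice (u : EuclideanSpace ℝ (Fin n)) L h
  have himage : ∀ B : Set (EuclideanSpace ℝ (Fin (n - 1))),
      μHE[n - 1] ((fun w => h • (u : EuclideanSpace ℝ (Fin n)) + L w) '' B) = volume B := by
    intro B
    rw [hiso.euclideanHausdorffMeasure_image, EuclideanSpace.euclideanHausdorffMeasure_eq_volume]
  have hAc : Convex ℝ A := K.convex.slice
  have hAcomp : IsCompact A := K.isCompact.slice
  have hmeas : μHE[n - 1] (Subtype.val '' (K.gaussMap ⁻¹' {u})) = volume A := by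
    apply le_antisymm
    · rw [← himage A]
      refine measure_mono ?_
      rintro _ ⟨x, hx, rfl⟩
      rw [image_slice hL hu]
      exact ⟨K.isCompact.isClosed.frontier_subset x.2.1, hinner x hx⟩
    · have hint : volume A ≤ volume (interior A) := by
        have hsub : A ⊆ interior A ∪ frontier A := by
          rw [← closure_eq_interior_union_frontier]
          exact subset_closure
        refine (measure_mono hsub).trans ((measure_union_le _ _).trans ?_)
        rw [hAc.addHaar_frontier volume, add_zero]
      refine hint.trans ?_
      rw [← himage]
      refine measure_mono ?_
      rintro _ ⟨w, hw, rfl⟩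
      have hwA : w ∈ A := interior_subset hw
      have hxK : h • (u : EuclideanSpace ℝ (Fin n)) + L w ∈ K := hwA
      have hxu : ⟪h • (u : EuclideanSpace ℝ (Fin n)) + L w,
          (u : EuclideanSpace ℝ (Fin n))⟫_ℝ = h := by
        rw [inner_add_left, real_inner_smul_left, real_inner_self_eq_norm_sq, hu,
          (hL _).1 (mem_range_self w)]
        ring
      have hnormal : K.IsOuterNormal (h • (u : EuclideanSpace ℝ (Fin n)) + L w) u := by
        intro y hy
        rw [hxu]
        exact inner_le_supportFunction hy
      have hfr : h • (u : EuclideanSpace ℝ (Fin n)) + L w ∈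
          frontier (K : Set (EuclideanSpace ℝ (Fin n))) := by
        refine ⟨subset_closure hxK, fun hi => ?_⟩
        obtain ⟨ε, hε, hmem⟩ :=
          add_smul_mem_of_mem_interior (v := (u : EuclideanSpace ℝ (Fin n))) hi
        have := inner_le_supportFunction (u := (u : EuclideanSpace ℝ (Fin n))) hmem
        rw [inner_add_left, hxu, real_inner_smul_left, real_inner_self_eq_norm_sq, hu] at this
        linarith
      have hreg : h • (u : EuclideanSpace ℝ (Fin n)) + L w ∈ K.regularBoundary :=
        ⟨hfr, u, hnormal, fun v hv => Subtype.ext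
          (IsOuterNormal.eq_of_mem_interior_slice hK0 hL hu hw (norm_eq_of_mem_sphere v) hv)⟩
      exact ⟨⟨_, hreg⟩, (K.gaussMap_unique ⟨_, hreg⟩ u hnormal).symm, rfl⟩
  rw [coneVolumeMeasure_apply K (measurableSet_singleton u)]
  have hcongr : ∀ x ∈ K.gaussMap ⁻¹' {u}, ENNReal.ofReal
      (⟪(x : EuclideanSpace ℝ (Fin n)), (K.gaussMap x : EuclideanSpace ℝ (Fin n))⟫_ℝ / n) =
      ENNReal.ofReal (h / n) := by
    intro x hx
    have hx' : K.gaussMap x = u := hx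
    rw [hx', hinner x hx]
  rw [setLIntegral_congr_fun (K.continuous_gaussMap.measurable (measurableSet_singleton u)) hcongr,
    setLIntegral_const, (MeasurableEmbedding.subtype_coe
      K.measurableSet_regularBoundary).comap_apply, hmeas,
    ← ENNReal.ofReal_toReal hAcomp.measure_ne_top, ← measureReal_def,
    ← ENNReal.ofReal_mul (by positivity)]
  congr 1
  ring

end ConvexBody

/-! ### Coordinates on the hyperplane, and convex hulls of two parallel faces. -/

theorem exists_linearIsometry_range_eq_orthogonal {n : ℕ} (hn : 1 ≤ n)
    {u : EuclideanSpace ℝ (Fin n)} (hu : ‖u‖ = 1) :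
    ∃ L : EuclideanSpace ℝ (Fin (n - 1)) →ₗᵢ[ℝ] EuclideanSpace ℝ (Fin n),
      ∀ x, x ∈ range L ↔ ⟪x, u⟫_ℝ = 0 := by
  have hu0 : u ≠ 0 := by
    rintro rfl
    simp at hu
  have : Fact (Module.finrank ℝ (EuclideanSpace ℝ (Fin n)) = n - 1 + 1) := ⟨by simp; omega⟩
  let b := OrthonormalBasis.fromOrthogonalSpanSingleton (𝕜 := ℝ) (n - 1) hu0
  refine ⟨(ℝ ∙ u)ᗮ.subtypeₗᵢ.comp b.repr.symm.toLinearIsometry, fun x => ?_⟩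
  rw [← Submodule.mem_orthogonal_singleton_iff_inner_left]
  constructor
  · rintro ⟨w, rfl⟩
    exact (b.repr.symm w).2
  · intro hx
    exact ⟨b.repr ⟨x, hx⟩, by simp⟩

theorem IsCompact.convexJoin {E : Type*} [AddCommGroup E] [Module ℝ E] [TopologicalSpace E]
    [ContinuousAdd E] [ContinuousSMul ℝ E] {A B : Set E} (hA : IsCompact A) (hB : IsCompact B) :
    IsCompact (_root_.convexJoin ℝ A B) := by
  have : _root_.convexJoin ℝ A B = (fun x : E × E × ℝ => (1 - x.2.2) • x.1 + x.2.2 • x.2.1) ''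
      (A ×ˢ B ×ˢ Icc (0 : ℝ) 1) := by
    ext z
    simp only [mem_convexJoin, segment_eq_image, mem_image, mem_prod, Prod.exists]
    constructor
    · rintro ⟨x, hx, y, hy, θ, hθ, rfl⟩
      exact ⟨x, y, θ, ⟨hx, hy, hθ⟩, rfl⟩
    · rintro ⟨x, y, θ, ⟨hx, hy, hθ⟩, rfl⟩
      exact ⟨x, hx, y, hy, θ, hθ, rfl⟩
  rw [this]
  exact (hA.prod (hB.prod isCompact_Icc)).image (by fun_prop)

section Slice

set_option linter.unusedSectionVars false

open Module

theorem volume_image_add_smul {V : Type*} [NormedAddCommGroup V] [NormedSpace ℝ V]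
    [FiniteDimensional ℝ V] [MeasureSpace V] [BorelSpace V] [(volume : Measure V).IsAddHaarMeasure]
    (g : V) {k : ℝ} (hk : 0 ≤ k) (B : Set V) :
    volume.real ((fun x => g + k • x) '' B) = k ^ finrank ℝ V * volume.real B := by
  rw [← image_image (fun x => g + x) (fun x => k • x), image_add_left, measureReal_def,
    measure_preimage_add, image_smul, Measure.addHaar_smul, ENNReal.toReal_mul,
    ENNReal.toReal_ofReal (abs_nonneg _), abs_of_nonneg (by positivity), measureReal_def]

variable {V E : Type*} [NormedAddCommGroup V] [InnerProductSpace ℝ V] [FiniteDimensional ℝ V]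
  [MeasurableSpace V] [BorelSpace V] [NormedAddCommGroup E] [InnerProductSpace ℝ E]
  [FiniteDimensional ℝ E] [MeasurableSpace E] [BorelSpace E] {u : E} {L : V →ₗᵢ[ℝ] E}

theorem volume_le_phiObjective
    (hL : ∀ x, x ∈ range L ↔ ⟪x, u⟫_ℝ = 0) (hu : ‖u‖ = 1) {n : ℕ} (hn : 1 ≤ n)
    (hE : finrank ℝ E = n) (hVd : finrank ℝ V = n - 1) {S : Set E} (hS : MeasurableSet S)
    {h₁ h₂ a b : ℝ} (h1 : 0 < h₁) (h2 : 0 < h₂) (ha : 0 < a) (hb : 0 < b)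
    (hout : ∀ s ∉ Icc (-h₂) h₁, slice u L S s = ∅)
    (hin : ∀ s ∈ Ioo (-h₂) h₁, volume (slice u L S s) ≤ ENNReal.ofReal
      (((h₂ + s) / (h₁ + h₂) * a + (h₁ - s) / (h₁ + h₂) * b) ^ (n - 1))) :
    volume S ≤ ENNReal.ofReal (phiObjective (h₁ * a ^ (n - 1) / n)
      (h₂ * b ^ (n - 1) / n) n (Real.sqrt (a / b))) := by
  rw [← lintegral_pow_affine h1 h2 ha hb hn,
    volume_eq_lintegral_slice hL hu (by rw [hE, hVd]) hS,
    ← lintegral_add_compl _ (measurableSet_Icc (a := -h₂) (b := h₁)),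
    setLIntegral_congr_fun (g := fun _ => 0) measurableSet_Icc.compl
      (fun s hs => by rw [hout s hs, measure_empty]), lintegral_zero, add_zero,
    ← restrict_Ioo_eq_restrict_Icc]
  exact setLIntegral_mono' measurableSet_Ioo hin

/-- The hull of two convex sets is the union of the segments joining them, and the height fixes the
weights on such a segment. -/
theorem exists_combination_of_mem_slice_convexHull
    (hL : ∀ x, x ∈ range L ↔ ⟪x, u⟫_ℝ = 0) (hu : ‖u‖ = 1) {h₁ h₂ : ℝ} (hh : 0 < h₁ + h₂)
    {A B : Set V} (hA : Convex ℝ A) (hB : Convex ℝ B) (hA0 : A.Nonempty) (hB0 : B.Nonempty)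
    {s : ℝ} {w : V} (hw : w ∈ slice u L (convexHull ℝ ((fun w => h₁ • u + L w) '' A ∪
      (fun w => (-h₂) • u + L w) '' B)) s) :
    s ∈ Icc (-h₂) h₁ ∧ ∃ x ∈ A, ∃ y ∈ B,
      w = ((h₂ + s) / (h₁ + h₂)) • x + ((h₁ - s) / (h₁ + h₂)) • y := by
  have haff : ∀ (t : ℝ) {A : Set V}, Convex ℝ A → Convex ℝ ((fun w => t • u + L w) '' A) := by
    intro t A hA
    rw [← image_image (fun x => t • u + x) L]
    exact (hA.linear_image L.toLinearMap).translate _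
  change s • u + L w ∈ convexHull ℝ _ at hw
  rw [(haff h₁ hA).convexHull_union (haff (-h₂) hB) (hA0.image _) (hB0.image _),
    mem_convexJoin] at hw
  obtain ⟨_, ⟨x, hx, rfl⟩, _, ⟨y, hy, rfl⟩, p, q, hp, hq, hpq, heq⟩ := hw
  have hinner : ∀ (t : ℝ) (z : V), ⟪t • u + L z, u⟫_ℝ = t := by
    intro t z
    rw [inner_add_left, real_inner_smul_left, real_inner_self_eq_norm_sq, hu,
      (hL _).1 (mem_range_self z)]
    ring
  have hs : p * h₁ + q * (-h₂) = s := by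
    have := congrArg (fun z => ⟪z, u⟫_ℝ) heq
    simpa only [inner_add_left (p • _), real_inner_smul_left, hinner] using this
  obtain rfl : q = 1 - p := by linarith
  have hp' : (h₂ + s) / (h₁ + h₂) = p := by
    rw [div_eq_iff hh.ne']
    linarith
  have hq' : (h₁ - s) / (h₁ + h₂) = 1 - p := by
    rw [div_eq_iff hh.ne']
    linarith
  refine ⟨⟨?_, ?_⟩, x, hx, y, hy, ?_⟩
  · nlinarith
  · nlinarith
  · rw [hp', hq']
    apply L.injective
    apply add_left_cancel (a := s • u)
    rw [← heq, ← hs]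
    simp only [map_add, map_smul]
    module

end Slice

/-- This identity always holds for `ϱ = √(a / b)`; thus the third equality condition merely says
that `ϱ` is the minimiser. -/
theorem div_eq_mul_zpow_sqrt {h₁ h₂ a b : ℝ} (h2 : 0 < h₂) (ha : 0 < a)
    (hb : 0 < b) {n : ℕ} (hn : 1 ≤ n) :
    h₁ / h₂ = h₁ * a ^ (n - 1) / n / (h₂ * b ^ (n - 1) / n) *
      Real.sqrt (a / b) ^ (-2 * ((n : ℤ) - 1)) := by
  have hn0 : (n : ℝ) ≠ 0 := by positivity
  have e : Real.sqrt (a / b) ^ (-2 * ((n : ℤ) - 1)) = ((a / b) ^ (n - 1))⁻¹ := by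
    rw [show -2 * ((n : ℤ) - 1) = -(2 * ((n - 1 : ℕ) : ℤ)) by omega, zpow_neg, zpow_mul]
    norm_cast
    rw [Real.sq_sqrt (div_pos ha hb).le]
  rw [e, div_pow]
  field_simp

/-! ### Homothetic faces and the reverse volume bound. -/

namespace ConvexBody

open Module

variable {n : ℕ} {K : ConvexBody (EuclideanSpace ℝ (Fin n))} {u : EuclideanSpace ℝ (Fin n)}
  {L : EuclideanSpace ℝ (Fin (n - 1)) →ₗᵢ[ℝ] EuclideanSpace ℝ (Fin n)}

theorem face_neg_eq_image_slice (hL : ∀ x, x ∈ range L ↔ ⟪x, u⟫_ℝ = 0) (hu : ‖u‖ = 1) :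
    K.face (-u) = (fun w => (-K.supportFunction (-u)) • u + L w) ''
      slice u L (K : Set (EuclideanSpace ℝ (Fin n))) (-K.supportFunction (-u)) := by
  rw [image_slice hL hu]
  ext x
  simp only [face, inner_neg_right, mem_ofPred_eq, neg_eq_iff_eq_neg, SetLike.mem_coe]

theorem exists_slice_eq_of_areHomothetic (hL : ∀ x, x ∈ range L ↔ ⟪x, u⟫_ℝ = 0) (hu : ‖u‖ = 1)
    (hB0 : (slice u L (K : Set (EuclideanSpace ℝ (Fin n))) (-K.supportFunction (-u))).Nonempty)
    (h : AreHomothetic (K.face u) (K.face (-u))) :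
    ∃ g, ∃ c : ℝ, 0 < c ∧
      slice u L (K : Set (EuclideanSpace ℝ (Fin n))) (K.supportFunction u) = (fun x => g + c • x) ''
        slice u L (K : Set (EuclideanSpace ℝ (Fin n))) (-K.supportFunction (-u)) := by
  obtain ⟨t, c, hc, h⟩ := h
  rw [face_eq_image_slice hL hu, face_neg_eq_image_slice hL hu, image_image] at h
  set h₁ := K.supportFunction u
  set h₂ := K.supportFunction (-u)
  set A := slice u L (K : Set (EuclideanSpace ℝ (Fin n))) h₁
  set B := slice u L (K : Set (EuclideanSpace ℝ (Fin n))) (-h₂)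
  have hinner : ∀ (t : ℝ) z, ⟪t • u + L z, u⟫_ℝ = t := by
    intro t z
    rw [inner_add_left, real_inner_smul_left, real_inner_self_eq_norm_sq, hu,
      (hL _).1 (mem_range_self z)]
    ring
  -- One point of the lower face fixes the `u`-component of `t`; the rest of `t` lies in the
  -- hyperplane.
  obtain ⟨g, hg⟩ : ∃ g, L g = t - (c * h₂ + h₁) • u := by
    obtain ⟨y, hy⟩ := hB0
    obtain ⟨x, hx, hxy⟩ : t + c • ((-h₂) • u + L y) ∈ (fun w => h₁ • u + L w) '' A := by
      rw [h]
      exact mem_image_of_mem _ hy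
    have := congrArg (fun z => ⟪z, u⟫_ℝ) hxy
    simp only [hinner, inner_add_left t, real_inner_smul_left] at this
    refine (hL _).2 ?_
    rw [inner_sub_left, real_inner_smul_left, real_inner_self_eq_norm_sq, hu]
    linarith
  refine ⟨g, c, hc, ?_⟩
  apply (isometry_slice u L h₁).injective.image_injective
  rw [h, image_image]
  congr 1
  ext1 y
  simp only [map_add, map_smul, hg]
  module

theorem areHomothetic_of_slice_eq (hL : ∀ x, x ∈ range L ↔ ⟪x, u⟫_ℝ = 0) (hu : ‖u‖ = 1)
    {g : EuclideanSpace ℝ (Fin (n - 1))} {c : ℝ} (hc : 0 < c)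
    (h : slice u L (K : Set (EuclideanSpace ℝ (Fin n))) (K.supportFunction u) =
      (fun x => g + c • x) ''
        slice u L (K : Set (EuclideanSpace ℝ (Fin n))) (-K.supportFunction (-u))) :
    AreHomothetic (K.face u) (K.face (-u)) := by
  refine ⟨(c * K.supportFunction (-u) + K.supportFunction u) • u + L g, c, hc, ?_⟩
  rw [face_eq_image_slice hL hu, face_neg_eq_image_slice hL hu, image_image, h, image_image]
  congr 1
  ext1 y
  simp only [map_add, map_smul]
  module

/-- If the upper slice is `g + c B`, a slice with weights `p`, `q` lies in `p g + (p c + q) B` by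
convexity of `B`. As `a = c b`, its volume is at most `(p a + q b) ^ (n - 1)`. -/
theorem volume_le_phiObjective_of_eq_convexHull (hL : ∀ x, x ∈ range L ↔ ⟪x, u⟫_ℝ = 0)
    (hu : ‖u‖ = 1) (hn : 2 ≤ n) (h1 : 0 < K.supportFunction u) (h2 : 0 < K.supportFunction (-u))
    {a b : ℝ} (ha : 0 < a) (hb : 0 < b)
    (hAa : volume.real (slice u L (K : Set (EuclideanSpace ℝ (Fin n))) (K.supportFunction u)) =
      a ^ (n - 1))
    (hBb : volume.real (slice u L (K : Set (EuclideanSpace ℝ (Fin n)))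
      (-K.supportFunction (-u))) = b ^ (n - 1))
    (hhom : AreHomothetic (K.face u) (K.face (-u)))
    (hK : (K : Set (EuclideanSpace ℝ (Fin n))) = convexHull ℝ (K.face u ∪ K.face (-u))) :
    volume (K : Set (EuclideanSpace ℝ (Fin n))) ≤
      ENNReal.ofReal (phiObjective (K.supportFunction u * a ^ (n - 1) / n)
        (K.supportFunction (-u) * b ^ (n - 1) / n) n (Real.sqrt (a / b))) := by
  have hd : n - 1 ≠ 0 := by omega
  have hVd : finrank ℝ (EuclideanSpace ℝ (Fin (n - 1))) = n - 1 := by simp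
  set h₁ := K.supportFunction u with hh₁
  set h₂ := K.supportFunction (-u) with hh₂
  have hh : 0 < h₁ + h₂ := by positivity
  set A := slice u L (K : Set (EuclideanSpace ℝ (Fin n))) h₁ with hA
  set B := slice u L (K : Set (EuclideanSpace ℝ (Fin n))) (-h₂) with hB
  have hB0 : B.Nonempty := by
    rw [nonempty_iff_ne_empty]
    intro h0
    rw [h0, measureReal_empty] at hBb
    exact (pow_pos hb _).ne hBb
  have hBc : Convex ℝ B := K.convex.slice
  obtain ⟨g, c, hc, hgc⟩ := exists_slice_eq_of_areHomothetic hL hu hB0 hhom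
  rw [← hh₁, ← hh₂, ← hA, ← hB] at hgc
  have hac : a = c * b := by
    rw [hgc, volume_image_add_smul g hc.le, hBb, hVd, ← mul_pow] at hAa
    exact ((pow_left_inj₀ (by positivity) ha.le hd).1 hAa).symm
  have hA0 : A.Nonempty := by
    rw [hgc]
    exact hB0.image _
  have hcomb : ∀ s w, w ∈ slice u L (K : Set (EuclideanSpace ℝ (Fin n))) s →
      s ∈ Icc (-h₂) h₁ ∧ ∃ x ∈ A, ∃ y ∈ B,
        w = ((h₂ + s) / (h₁ + h₂)) • x + ((h₁ - s) / (h₁ + h₂)) • y := by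
    intro s w hw
    rw [hK, face_eq_image_slice hL hu, face_neg_eq_image_slice hL hu] at hw
    exact exists_combination_of_mem_slice_convexHull hL hu hh K.convex.slice hBc hA0 hB0 hw
  refine volume_le_phiObjective hL hu (by omega) (by simp) hVd K.isCompact.measurableSet h1 h2 ha hb ?_ ?_
  · intro s hs
    rw [eq_empty_iff_forall_notMem]
    exact fun w hw => hs (hcomb s w hw).1
  · intro s hs
    set p := (h₂ + s) / (h₁ + h₂)
    set q := (h₁ - s) / (h₁ + h₂)
    have hp : 0 < p := div_pos (by linarith [hs.1]) hh
    have hq : 0 < q := div_pos (by linarith [hs.2]) hh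
    have hk : 0 < p * c + q := by positivity
    have hsub : slice u L (K : Set (EuclideanSpace ℝ (Fin n))) s ⊆
        (fun x => p • g + (p * c + q) • x) '' B := by
      intro w hw
      obtain ⟨-, x, hx, y, hy, rfl⟩ := hcomb s w hw
      rw [hgc] at hx
      obtain ⟨x, hx, rfl⟩ := hx
      refine ⟨(p * c / (p * c + q)) • x + (q / (p * c + q)) • y,
        hBc hx hy (by positivity) (by positivity) (by rw [← add_div, div_self hk.ne']), ?_⟩
      simp only [smul_add, smul_smul, mul_div_cancel₀ _ hk.ne', add_assoc]
      rfl
    have hfin : volume ((fun x => p • g + (p * c + q) • x) '' B) ≠ ⊤ := by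
      have hBcomp : IsCompact B := K.isCompact.slice
      exact (hBcomp.image (by fun_prop)).measure_ne_top
    refine (measure_mono hsub).trans ?_
    rw [← ENNReal.ofReal_toReal hfin, ← measureReal_def, volume_image_add_smul _ hk.le, hBb, hVd,
      ← mul_pow, hac]
    apply le_of_eq
    congr 2
    ring

end ConvexBody

/-! ### The inequality and its equality case. -/

theorem theorem1 (n : ℕ) (hn : 2 ≤ n) (K : ConvexBody (EuclideanSpace ℝ (Fin n)))
    (hK0 : (0 : EuclideanSpace ℝ (Fin n)) ∈ interior (K : Set (EuclideanSpace ℝ (Fin n))))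
    (hKvol : volume (K : Set (EuclideanSpace ℝ (Fin n))) = 1)
    (u : Metric.sphere (0 : EuclideanSpace ℝ (Fin n)) 1) (α β : ℝ) (hα : 0 < α) (hβ : 0 < β)
    (hKα : K.coneVolumeMeasure {u} = ENNReal.ofReal α)
    (hKβ : K.coneVolumeMeasure {-u} = ENNReal.ofReal β) :
    phi α β n ≤ 1 ∧
    (phi α β n = 1 ↔
      AreHomothetic (K.face u) (K.face (-u)) ∧
      (K : Set (EuclideanSpace ℝ (Fin n))) = convexHull ℝ (K.face u ∪ K.face (-u)) ∧
      K.supportFunction u / K.supportFunction (-u) =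
        α / β * rho0 (α / β) n ^ (-2 * ((n : ℤ) - 1))) := by
  have hn1 : 1 ≤ n := by omega
  have hn0 : (n : ℝ) ≠ 0 := by positivity
  have hd : n - 1 ≠ 0 := by omega
  have hu : ‖(u : EuclideanSpace ℝ (Fin n))‖ = 1 := norm_eq_of_mem_sphere u
  have hE : Module.finrank ℝ (EuclideanSpace ℝ (Fin n)) = n := by simp
  have hVd : Module.finrank ℝ (EuclideanSpace ℝ (Fin (n - 1))) = n - 1 := by simp
  have hPL := prekopaLeindler_euclideanSpace (n - 1)
  obtain ⟨L, hL⟩ := exists_linearIsometry_range_eq_orthogonal hn1 hu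
  have h1 := ConvexBody.supportFunction_pos hK0 hu
  have h2 := ConvexBody.supportFunction_pos hK0 (u := -(u : EuclideanSpace ℝ (Fin n)))
    (by rw [norm_neg, hu])
  rw [ConvexBody.coneVolumeMeasure_singleton hK0 u hL] at hKα
  rw [ConvexBody.coneVolumeMeasure_singleton hK0 (-u) (L := L)
    (by simpa [inner_neg_right] using hL)] at hKβ
  simp only [coe_neg_sphere] at hKβ
  have hface₁ := ConvexBody.face_eq_image_slice (K := K) hL hu
  have hface₂ := ConvexBody.face_neg_eq_image_slice (K := K) hL hu
  -- The slice seen from `-u` is rewritten in direction `u`, so one isometry `L` serves both faces.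
  have hneg : slice (-(u : EuclideanSpace ℝ (Fin n))) L (K : Set (EuclideanSpace ℝ (Fin n)))
      (K.supportFunction (-(u : EuclideanSpace ℝ (Fin n)))) =
      slice (u : EuclideanSpace ℝ (Fin n)) L (K : Set (EuclideanSpace ℝ (Fin n)))
      (-K.supportFunction (-(u : EuclideanSpace ℝ (Fin n)))) := by
    simp only [slice, smul_neg, neg_smul]
  rw [hneg] at hKβ
  set v : EuclideanSpace ℝ (Fin n) := (u : EuclideanSpace ℝ (Fin n))
  have hvolK := fun (a b : ℝ) => ConvexBody.volume_le_phiObjective_of_eq_convexHull (K := K)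
    (a := a) (b := b) hL hu hn h1 h2
  have hhomK := fun (g : EuclideanSpace ℝ (Fin (n - 1))) (c : ℝ) =>
    ConvexBody.areHomothetic_of_slice_eq (K := K) (g := g) (c := c) hL hu
  set h₁ := K.supportFunction v
  set h₂ := K.supportFunction (-v)
  set A := slice v L (K : Set (EuclideanSpace ℝ (Fin n))) h₁ with hAdef
  set B := slice v L (K : Set (EuclideanSpace ℝ (Fin n))) (-h₂) with hBdef
  have hα' : h₁ * volume.real A / n = α := by
    rwa [ENNReal.ofReal_eq_ofReal_iff (by positivity) hα.le] at hKα
  have hβ' : h₂ * volume.real B / n = β := by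
    rwa [ENNReal.ofReal_eq_ofReal_iff (by positivity) hβ.le] at hKβ
  have hroot : ∀ (S : Set (EuclideanSpace ℝ (Fin (n - 1)))) (h γ : ℝ), 0 < γ →
      h * volume.real S / n = γ → ∃ a : ℝ, 0 < a ∧ volume.real S = a ^ (n - 1) := by
    intro S h γ hγ he
    have hpos : 0 < volume.real S := by
      refine lt_of_le_of_ne measureReal_nonneg fun h0 => ?_
      rw [← h0] at he
      simp at he
      exact hγ.ne he
    exact ⟨(volume.real S) ^ (((n - 1 : ℕ) : ℝ)⁻¹), Real.rpow_pos_of_pos hpos _,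
      (Real.rpow_inv_natCast_pow hpos.le hd).symm⟩
  obtain ⟨a, ha, hAa⟩ := hroot A h₁ α hα hα'
  obtain ⟨b, hb, hBb⟩ := hroot B h₂ β hβ hβ'
  rw [hAa] at hα'
  rw [hBb] at hβ'
  have hvolK := hvolK a b ha hb hAa hBb
  have hratio := div_eq_mul_zpow_sqrt (h₁ := h₁) h2 ha hb hn1
  set ρ := Real.sqrt (a / b)
  have hρ : 0 < ρ := Real.sqrt_pos.2 (div_pos ha hb)
  have hle : ∀ S : Set (EuclideanSpace ℝ (Fin n)), IsCompact S → Convex ℝ S →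
      slice v L S h₁ = A → slice v L S (-h₂) = B →
      ENNReal.ofReal (phiObjective α β n ρ) ≤ volume S := by
    intro S hS hSc hSA hSB
    have := phiObjective_le_volume hPL hL hu hn1 hE hVd hS hSc h1 h2 ha hb
      (by rw [hSA, hAa]) (by rw [hSB, hBb])
    rwa [hα', hβ'] at this
  have hleast := phi_isLeast hα hβ hn
  have hphi : phi α β n ≤ phiObjective α β n ρ := hleast.2 (mem_image_of_mem _ hρ)
  have hobj : phiObjective α β n ρ ≤ 1 := by
    have := hle K K.isCompact K.convex rfl rfl
    rwa [hKvol, ENNReal.ofReal_le_one] at this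
  rw [hα', hβ'] at hratio hvolK
  refine ⟨hphi.trans hobj, ?_, ?_⟩
  · intro heq
    have hobj1 : phiObjective α β n ρ = 1 := le_antisymm hobj (heq ▸ hphi)
    have hρ0 : ρ = rho0 (α / β) n := by
      rw [← isMinOn_phiObjective_iff hα hβ hn]
      refine ⟨hρ, fun x hx => ?_⟩
      rw [mem_ofPred_eq, hobj1, ← heq]
      exact hleast.2 (mem_image_of_mem _ hx)
    set C := convexHull ℝ (K.face v ∪ K.face (-v))
    have hCK : C ⊆ K := convexHull_min
      (union_subset ConvexBody.face_subset ConvexBody.face_subset) K.convex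
    have hne : ∀ (S : Set (EuclideanSpace ℝ (Fin (n - 1)))) (a : ℝ), 0 < a →
        volume.real S = a ^ (n - 1) → S.Nonempty := by
      intro S a ha hS
      rw [nonempty_iff_ne_empty]
      rintro rfl
      rw [measureReal_empty] at hS
      exact (pow_pos ha _).ne hS
    have hCcomp : IsCompact C := by
      have h := (K.isCompact_face v).convexJoin (K.isCompact_face (-v))
      rwa [← (K.convex_face v).convexHull_union (K.convex_face (-v))
        (by rw [hface₁]; exact (hne A a ha hAa).image _)
        (by rw [hface₂]; exact (hne B b hb hBb).image _)] at h
    have hCc : Convex ℝ C := convex_convexHull ℝ _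
    have hCA : slice v L C h₁ = A := Subset.antisymm (fun w hw => hCK hw) fun w hw =>
      subset_convexHull ℝ _ (Or.inl (by rw [hface₁]; exact mem_image_of_mem _ hw))
    have hCB : slice v L C (-h₂) = B := Subset.antisymm (fun w hw => hCK hw) fun w hw =>
      subset_convexHull ℝ _ (Or.inr (by rw [hface₂]; exact mem_image_of_mem _ hw))
    -- The hull lies in `K` and has the same extreme slices, so it is squeezed between the lower
    -- bound 1 and `V(K) = 1`.
    have hCvol : volume C = 1 := by
      refine le_antisymm (hKvol ▸ measure_mono hCK) ?_
      have := hle C hCcomp hCc hCA hCB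
      rwa [hobj1, ENNReal.ofReal_one] at this
    refine ⟨?_, ?_, ?_⟩
    · obtain ⟨s, hs, hvs⟩ := exists_volume_slice_eq hPL hL hu hn1 hE hVd hCcomp hCc h1 h2 ha hb
        (by rw [hCA, hAa]) (by rw [hCB, hBb])
        (by rw [hα', hβ', hobj1, hCvol, ENNReal.ofReal_one])
      have hh : 0 < h₁ + h₂ := by positivity
      have hp : 0 < (h₂ + s) / (h₁ + h₂) := div_pos (by linarith [hs.1]) hh
      have hq : 0 < (h₁ - s) / (h₁ + h₂) := div_pos (by linarith [hs.2]) hh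
      -- At height `s = p h₁ - q h₂` the slice has exactly the Brunn–Minkowski volume, so the
      -- equality case applies to the faces.
      obtain ⟨g, c, hc, hgc⟩ := exists_eq_image_add_smul_of_volume_eq hPL (by omega)
        (A := A) (B := B) (C := slice v L C s) K.isCompact.slice K.convex.slice
        K.isCompact.slice K.convex.slice hCcomp.slice hCc.slice hp hq
        (fun x hx y hy => by
          rw [← hCA] at hx
          rw [← hCB] at hy
          have := slice_combination hCc hp.le hq.le (by field_simp; ring) hx hy
          convert! this using 2
          field_simp
          ring)
        ha hb (by rw [hVd, hAa]) (by rw [hVd, hBb]) (by rw [hVd, hvs])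
      exact hhomK g c hc hgc
    · refine Subset.antisymm ?_ hCK
      refine K.convex.subset_of_volume_sdiff_eq_zero ⟨0, hK0⟩ hCcomp.isClosed ?_
      rw [measure_sdiff hCK hCcomp.measurableSet.nullMeasurableSet hCcomp.measure_ne_top, hKvol,
        hCvol, tsub_self]
    · rw [← hρ0]
      exact hratio
  · rintro ⟨hhom, hconv, hrat⟩
    have hρ0 : ρ = rho0 (α / β) n := by
      have hpos := ((isMinOn_phiObjective_iff hα hβ hn _).2 rfl).1
      rw [hratio] at hrat
      have := mul_left_cancel₀ (div_pos hα hβ).ne' hrat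
      -- The exponent `-2 (n - 1)` is nonzero because `n ≥ 2`.
      exact (zpow_left_inj₀ hρ.le hpos.le (by omega)).1 this
    have hmin := ((isMinOn_phiObjective_iff hα hβ hn ρ).2 hρ0).2
    have hge : 1 ≤ phiObjective α β n ρ := by
      have := hvolK hhom hconv
      rwa [hKvol, ENNReal.one_le_ofReal] at this
    refine le_antisymm (hphi.trans hobj) (hge.trans ?_)
    obtain ⟨x, hx, hxe⟩ := hleast.1
    rw [← hxe]
    exact hmin hx
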